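/- Conventions. A vertex algebra is a $\mathbb C$-vector space $V$ with a linear map $a\mapsto Y(a,z)=\sum_{n\in\mathbb Z}a(n)z^{-n-1}\in \mathrm{End}(V)[[z^{\pm1}]]$ and a vector $\mathbf 1\neq 0$ such that, for all $a,b\in V$, $a(n)b=0$ for $n\gg0$; $a(n)\mathbf 1=0$ for $n\ge 0$ and $a(-1)\mathbf 1=a$; and the Borcherds identity holds. Put $Ta=a(-2)\mathbf 1$. A conformal vertex algebra $(V,\omega)$ is a vertex algebra with $\omega\in V$ such that the operators $L(n)=\omega(n+1)$ satisfy the Virasoro relations for some central charge $c\in\mathbb C$, $L(-1)=T$, and $L(0)$ is semisimple with integral eigenvalues; $V_n=\{v: L(0)v=nv\}$. A Heisenberg subspace is a subspace $H\subset V$ such that $h(1)h'\in\mathbb C\mathbf 1$ and $h(n)h'=0$ for all $n\ge 2$ and $h,h'\in H$, and such that the bilinear form on $H$ given by $h(1)h'=(h,h')\mathbf 1$ is non-degenerate. For $n\in\mathbb Z$ and $\alpha\in H$ put $V_n^\alpha=\{v\in V_n: h(0)v=(h,\alpha)v \text{ for all } h\in H\}$, $M_{V,H}=\{\alpha\in H: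 V_n^\alpha\ne0\text{ for some }n\in\mathbb Z\}$ and $V_H^\vee=\bigoplus_{n\in\mathbb Z,\ \alpha\in M_{V,H}}(V_n^\alpha)^*$, on which $V$ acts by $Y_{V_H^\vee}(a,z)f(-)=f\bigl(Y(e^{L(1)z}(-z^{-2})^{L(0)}a,z^{-1})-\bigr)$. Assumption (A) on a triple $(V,\omega,H)$ of a conformal vertex algebra and a Heisenberg subspace says: (A1) $L(n)h=0$ and $L(0)h=h$ for all $n\ge1$, $h\in H$; (A2) $h(0)$ is semisimple on $V$ for every $h\in H$; (A3) $(\alpha,\beta)\in\mathbb R$ for all $\alpha,\beta\in M_{V,H}$; (A4) $V_n^\alpha=0$ if $(\alpha,\alpha)/2>n$; (A5) $V_0^0=\mathbb C\mathbf 1$ and $V_1^0=H$; (A6) every $V_n^\alpha$ is finite dimensional; (A7) $V_H^\vee\cong V$ as $V$-modules. For $k\in\mathbb C$, $k\neq-2$, let $L_{\mathfrak{sl}_2}(k,0)$ be the simple affine vertex algebra of level $k$, i.e. the irreducible quotient of the level-$k$ vacuum module of the affine Lie algebra $\mathfrak{sl}_2\otimes\mathbb C[t^{\pm1}]\oplus\mathbb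 CK$ (with respect to the form $\mathrm{tr}(xy)$ on $\mathfrak{sl}_2$), with its standard vertex algebra structure, determined by $Y(x(-1)\mathbf 1,z)=\sum_n x(n)z^{-n-1}$ for $x\in\mathfrak{sl}_2$. Theorem. Let $(V,\omega,H)$ satisfy Assumption (A). (1) Let $\alpha\in M_{V,H}$ be such that $(\alpha,\alpha)>0$ and $V_1^\alpha\neq0$. Then $k=2/(\alpha,\alpha)$ is a positive integer and the vertex subalgebra of $V$ generated by $V_1^\alpha$ and $V_1^{-\alpha}$ is isomorphic to $L_{\mathfrak{sl}_2}(k,0)$. Moreover $\dim V_1^{\alpha}=\dim V_1^{-\alpha}=1$, and $V_1^{m\alpha}=0$ for every $m\in\mathbb C\setminus\{-1,0,1\}$. (2) If $\beta\in M_{V,H}$ and $n\in\mathbb Z$ satisfy $n\ge\frac{(\beta,\beta)}2>n-1$, then $\dim V_n^\beta\in\{0,1\}$. -/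

import Mathlib

open scoped TensorProduct

noncomputable section

/-! ## Vertex algebras -/

/-- A vertex algebra over `ℂ`: `mode a n b` is the `n`-th product `a(n)b`, and `vac` is the vacuum
vector `𝟏`.  All sums in the Borcherds identity have finitely many non-zero terms, by
`eventually_zero`. -/
structure VertexAlgebra (V : Type*) [AddCommGroup V] [Module ℂ V] where
  mode : V →ₗ[ℂ] (ℤ → Module.End ℂ V)
  vac : V
  vac_ne_zero : vac ≠ 0
  eventually_zero : ∀ a b : V, ∃ N : ℤ, ∀ n : ℤ, N ≤ n → mode a n b = 0
  mode_vac_of_nonneg : ∀ (a : V) (n : ℤ), 0 ≤ n → mode a n vac = 0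
  mode_vac_neg_one : ∀ a : V, mode a (-1) vac = a
  borcherds : ∀ (a b c : V) (p q r : ℤ),
    (∑ᶠ i : ℕ, ((Ring.choose p i : ℤ) : ℂ) • mode (mode a (r + i) b) (p + q - i) c) =
      ∑ᶠ i : ℕ, ((-1 : ℂ) ^ i * ((Ring.choose r i : ℤ) : ℂ)) •
        (mode a (p + r - i) (mode b (q + i) c)
          - ((-1 : ℂ) ^ r) • mode b (q + r - i) (mode a (p + i) c))

namespace VertexAlgebra

variable {V W : Type*} [AddCommGroup V] [Module ℂ V] [AddCommGroup W] [Module ℂ W]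

/-- A homomorphism of vertex algebras: a linear map that preserves the vacuum and all products. -/
structure Hom (A : VertexAlgebra V) (B : VertexAlgebra W) where
  toLinearMap : V →ₗ[ℂ] W
  map_vac : toLinearMap A.vac = B.vac
  map_mode : ∀ (a b : V) (n : ℤ),
    toLinearMap (A.mode a n b) = B.mode (toLinearMap a) n (toLinearMap b)

/-- The vertex subalgebra generated by a set `S`: the smallest subspace that contains `𝟏` and `S`
and is closed under all the products. -/
def generated (A : VertexAlgebra V) (S : Set V) : Submodule ℂ V :=
  sInf {U : Submodule ℂ V | A.vac ∈ U ∧ S ⊆ U ∧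
    ∀ a ∈ U, ∀ b ∈ U, ∀ n : ℤ, A.mode a n b ∈ U}

/-- `L(n) = ω(n+1)`. -/
def vir (A : VertexAlgebra V) (ω : V) (n : ℤ) : Module.End ℂ V := A.mode ω (n + 1)

/-- `ω` is a conformal vector, i.e. `(V, ω)` is a conformal vertex algebra.  The last condition says
that `L(0)` is semisimple (diagonalizable) with integral eigenvalues. -/
structure IsConformal (A : VertexAlgebra V) (ω : V) : Prop where
  virasoro : ∃ c : ℂ, ∀ (m n : ℤ) (v : V),
    A.vir ω m (A.vir ω n v) - A.vir ω n (A.vir ω m v) =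
      ((m : ℂ) - n) • A.vir ω (m + n) v
        + (if m + n = 0 then (((m : ℂ) ^ 3 - m) / 12 * c) • v else 0)
  translation : ∀ v : V, A.vir ω (-1) v = A.mode v (-2) A.vac
  semisimple : (⨆ n : ℤ, (A.vir ω 0).eigenspace (n : ℂ)) = ⊤

/-- A Heisenberg subspace `H` of `V`, with its (uniquely determined) bilinear form. -/
structure HeisenbergSubspace (A : VertexAlgebra V) where
  carrier : Submodule ℂ V
  form : LinearMap.BilinForm ℂ carrier
  mode_one : ∀ h h' : carrier, A.mode (h : V) 1 (h' : V) = form h h' • A.vac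
  mode_of_two_le : ∀ (h h' : carrier) (n : ℤ), 2 ≤ n → A.mode (h : V) n (h' : V) = 0
  nondegenerate : form.Nondegenerate

/-- `V_n^α`: the vectors `v` with `L(0)v = nv` and `h(0)v = (h,α)v` for all `h ∈ H`. -/
def weightSpace (A : VertexAlgebra V) (ω : V) (H : A.HeisenbergSubspace) (n : ℤ)
    (α : H.carrier) : Submodule ℂ V :=
  (A.vir ω 0).eigenspace (n : ℂ) ⊓
    ⨅ h : H.carrier, (A.mode (h : V) 0).eigenspace (H.form h α)

/-- `M_{V,H}`: the `α ∈ H` such that `V_n^α ≠ 0` for some `n`. -/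
def weights (A : VertexAlgebra V) (ω : V) (H : A.HeisenbergSubspace) : Set H.carrier :=
  {α | ∃ n : ℤ, A.weightSpace ω H n α ≠ ⊥}

/-- The restricted dual `V_H^∨ = ⨁ (V_n^α)^*`.  The summand `(V_n^α)^*` is realised as the space of
functionals on `V = ⨁ V_n^α` that vanish on all the other weight spaces. -/
def restrictedDual (A : VertexAlgebra V) (ω : V) (H : A.HeisenbergSubspace) :
    Submodule ℂ (Module.Dual ℂ V) :=
  ⨆ (n : ℤ) (α : H.carrier),
    ⨅ (m : ℤ) (β : H.carrier) (_ : (m, β) ≠ (n, α)),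
      (A.weightSpace ω H m β).dualAnnihilator

/-- For `a ∈ V` with `L(0)a = na`, the coefficient of `z^{-k-1}` in
`Y(e^{L(1)z}(-z^{-2})^{L(0)}a, z^{-1})u`, that is
`(-1)^n ∑_{i ≥ 0} (1/i!) (L(1)^i a)(2n-k-i-2)u`
(a finite sum when `L(1)` is locally nilpotent). -/
def oppositeMode (A : VertexAlgebra V) (ω : V) (n : ℤ) (a : V) (k : ℤ) (u : V) : V :=
  ((-1 : ℂ) ^ n) • ∑ᶠ i : ℕ, ((Nat.factorial i : ℂ)⁻¹) •
    A.mode ((A.vir ω 1 ^ i) a) (2 * n - k - i - 2) u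

/-- `V_H^∨ ≅ V` as `V`-modules, where `a(k)` acts on `V_H^∨` by
`(a(k)f)(u) = f(oppositeMode a k u)` for `L(0)`-homogeneous `a`, and hence, by linearity, for
all `a`. -/
def IsSelfDual (A : VertexAlgebra V) (ω : V) (H : A.HeisenbergSubspace) : Prop :=
  ∃ φ : V ≃ₗ[ℂ] A.restrictedDual ω H,
    ∀ (n : ℤ) (a : V), a ∈ (A.vir ω 0).eigenspace (n : ℂ) → ∀ (k : ℤ) (v u : V),
      (φ (A.mode a k v) : Module.Dual ℂ V) u =
        (φ v : Module.Dual ℂ V) (A.oppositeMode ω n a k u)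

/-- Assumption (A) on a triple `(V, ω, H)`.  In `A4` only `α ∈ M_{V,H}` matter, for which `(α,α)` is
real by `A3`. -/
structure AssumptionA (A : VertexAlgebra V) (ω : V) (H : A.HeisenbergSubspace) : Prop where
  conformal : A.IsConformal ω
  A1 : ∀ h : H.carrier, A.vir ω 0 (h : V) = h ∧ ∀ n : ℤ, 1 ≤ n → A.vir ω n (h : V) = 0
  A2 : ∀ h : H.carrier, (⨆ μ : ℂ, (A.mode (h : V) 0).eigenspace μ) = ⊤
  A3 : ∀ α ∈ A.weights ω H, ∀ β ∈ A.weights ω H, (H.form α β).im = 0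
  A4 : ∀ (n : ℤ) (α : H.carrier), (n : ℝ) < (H.form α α).re / 2 → A.weightSpace ω H n α = ⊥
  A5_zero : A.weightSpace ω H 0 0 = Submodule.span ℂ {A.vac}
  A5_one : A.weightSpace ω H 1 0 = H.carrier
  A6 : ∀ (n : ℤ) (α : H.carrier), FiniteDimensional ℂ (A.weightSpace ω H n α)
  A7 : A.IsSelfDual ω H

end VertexAlgebra

/-! ## The simple affine vertex algebra of `sl₂` -/

namespace AffineSl2

/-- The Lie algebra `sl₂(ℂ)` of traceless `2 × 2` matrices. -/
abbrev Sl2 := LieAlgebra.SpecialLinear.sl (Fin 2) ℂ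

/-- The normalized invariant form `⟨x, y⟩ = tr(xy)` on `sl₂`, for which long roots have square
length `2`. -/
def form : LinearMap.BilinForm ℂ Sl2 :=
  LinearMap.mk₂ ℂ (fun x y : Sl2 => Matrix.trace (x.1 * y.1))
    (by intro x y z; simp [add_mul])
    (by intro c x y; simp)
    (by intro x y z; simp [mul_add])
    (by intro c x y; simp)

theorem form_apply (x y : Sl2) : form x y = Matrix.trace (x.1 * y.1) := rfl

theorem form_isSymm : form.IsSymm :=
  ⟨fun x y => by simp [form_apply, Matrix.trace_mul_comm x.1 y.1]⟩

theorem form_lieInvariant : form.lieInvariant Sl2 := by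
  intro x y z
  simp only [form_apply, LieAlgebra.SpecialLinear.sl_bracket, sub_mul, mul_sub, Matrix.trace_sub]
  rw [neg_sub, Matrix.mul_assoc y.1 x.1 z.1, Matrix.mul_assoc x.1 y.1 z.1,
    Matrix.trace_mul_comm x.1 (y.1 * z.1), Matrix.mul_assoc y.1 z.1 x.1]

theorem neg_form_isSymm : (-form).IsSymm :=
  ⟨fun x y => by simpa using form_isSymm.eq x y⟩

theorem neg_form_lieInvariant : (-form).lieInvariant Sl2 := by
  intro x y z
  simp [form_lieInvariant x y z]

/-- The cocycle `(x ⊗ t^m, y ⊗ t^n) ↦ m δ_{m+n,0} ⟨x,y⟩` on the loop algebra of `sl₂`.  Mathlib's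
cocycle attached to a form `Φ` is `n δ_{m+n,0} Φ(x,y)`, whence the sign. -/
abbrev cocycle := LieAlgebra.LoopAlgebra.twoCocycleOfBilinear ℂ ℤ Sl2 (-form)
  neg_form_lieInvariant neg_form_isSymm

/-- The affine Lie algebra `sl₂ ⊗ ℂ[t,t⁻¹] ⊕ ℂK`. -/
abbrev Affine := LieAlgebra.ofTwoCocycle cocycle

/-- `x(n) = x ⊗ t^n`. -/
def current (x : Sl2) (n : ℤ) : Affine :=
  LieAlgebra.ofProd cocycle (AddMonoidAlgebra.single n (1 : ℂ) ⊗ₜ[ℂ] x, 0)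

/-- The central element `K`. -/
def central : Affine :=
  LieAlgebra.ofProd cocycle
    (0, (TrivialLieModule.equiv ℂ (LieAlgebra.loopAlgebra ℂ ℤ Sl2) ℂ).symm 1)

/-- The bracket of a central extension. -/
theorem lie_ofProd {R L M : Type*} [CommRing R] [LieRing L] [LieAlgebra R L] [AddCommGroup M]
    [Module R M] (c : LieModule.Cohomology.twoCocycle R L (TrivialLieModule R L M))
    (x y : L) (a b : TrivialLieModule R L M) :
    ⁅LieAlgebra.ofProd c (x, a), LieAlgebra.ofProd c (y, b)⁆ =
      LieAlgebra.ofProd c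
        (⁅x, y⁆, (c : LieModule.Cohomology.twoCochain R L (TrivialLieModule R L M)) x y) := by
  rw [LieAlgebra.bracket_ofTwoCocycle]
  simp [LieModule.IsTrivial.trivial]

theorem ofProd_eq_add {R L : Type*} [CommRing R] [LieRing L] [LieAlgebra R L]
    (c : LieModule.Cohomology.twoCocycle R L (TrivialLieModule R L R)) (x : L) (r : R) :
    LieAlgebra.ofProd c (x, (TrivialLieModule.equiv R L R).symm r) =
      LieAlgebra.ofProd c (x, 0) +
        r • LieAlgebra.ofProd c (0, (TrivialLieModule.equiv R L R).symm 1) := by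
  rw [← LieAlgebra.of_smul, ← LieAlgebra.of_add]
  simp [← map_smul]

theorem residuePairing_single (x y : Sl2) (m n : ℤ) :
    LieAlgebra.LoopAlgebra.residuePairing ℂ ℤ Sl2 (-form)
      (AddMonoidAlgebra.single m (1 : ℂ) ⊗ₜ[ℂ] x) (AddMonoidAlgebra.single n (1 : ℂ) ⊗ₜ[ℂ] y) =
      if m + n = 0 then (m : ℂ) * form x y else 0 := by
  rw [LieAlgebra.LoopAlgebra.residuePairing_apply_apply,
    LieAlgebra.LoopAlgebra.toFinsupp_single_tmul, LieAlgebra.LoopAlgebra.toFinsupp_single_tmul,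
    Finsupp.sum_single_index (by simp)]
  by_cases h : m + n = 0
  · obtain rfl : n = -m := by omega
    simp
  · have h' : m ≠ -n := by omega
    simp [h, Finsupp.single_eq_of_ne' h']

/-- The commutation relations of the affine Lie algebra. -/
theorem lie_current (x y : Sl2) (m n : ℤ) :
    ⁅current x m, current y n⁆ =
      current ⁅x, y⁆ (m + n) + (if m + n = 0 then (m : ℂ) * form x y else 0) • central := by
  refine (lie_ofProd cocycle _ _ _ _).trans ?_
  rw [LieAlgebra.ExtendScalars.bracket_tmul, AddMonoidAlgebra.single_mul_single, mul_one,
    ← residuePairing_single]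
  exact ofProd_eq_add cocycle _ _

theorem lie_central (X : Affine) : ⁅X, central⁆ = 0 := by
  obtain ⟨⟨x, a⟩⟩ := X
  refine (lie_ofProd cocycle x 0 a _).trans ?_
  rw [lie_zero, map_zero]
  rfl

/-- The universal enveloping algebra of the affine Lie algebra. -/
abbrev Env := UniversalEnvelopingAlgebra ℂ Affine

/-- The left ideal generated by `x(n)` (`x ∈ sl₂`, `n ≥ 0`) and `K - k`. -/
def vacuumIdeal (k : ℂ) : Submodule Env Env :=
  Submodule.span Env
    ({u | ∃ (x : Sl2) (n : ℤ), 0 ≤ n ∧ u = UniversalEnvelopingAlgebra.ι ℂ (current x n)} ∪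
      {UniversalEnvelopingAlgebra.ι ℂ central - algebraMap ℂ Env k})

/-- The vacuum (generalized Verma) module of level `k`, induced from the one-dimensional module of
`sl₂ ⊗ ℂ[t] ⊕ ℂK` on which `sl₂ ⊗ ℂ[t]` acts by `0` and `K` by `k`. -/
abbrev VacuumModule (k : ℂ) := Env ⧸ vacuumIdeal k

/-- The sum of all proper submodules of the vacuum module.  For `k ≠ -2` it is the unique maximal
proper submodule. -/
def maximalSubmodule (k : ℂ) : Submodule Env (VacuumModule k) :=
  sSup {N | N ≠ ⊤}

/-- The space `L_{sl₂}(k,0)`: the irreducible quotient of the vacuum module of level `k`. -/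
abbrev SimpleQuotient (k : ℂ) := VacuumModule k ⧸ maximalSubmodule k

/-- The image of `1` in `L_{sl₂}(k,0)`. -/
def vacuum (k : ℂ) : SimpleQuotient k :=
  (maximalSubmodule k).mkQ ((vacuumIdeal k).mkQ 1)

/-- The action of `x(n)` on `L_{sl₂}(k,0)`. -/
def act (k : ℂ) (x : Sl2) (n : ℤ) (u : SimpleQuotient k) : SimpleQuotient k :=
  (UniversalEnvelopingAlgebra.ι ℂ (current x n) : Env) • u

/-- A vertex algebra structure on the space `L_{sl₂}(k,0)` is the standard one if its vacuum is the
image of `1` and `Y(x(-1)𝟏, z) = ∑ x(n) z^{-n-1}` for all `x ∈ sl₂`.  There is at most one such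
structure, as `L_{sl₂}(k,0)` is generated by the vectors `x(-1)𝟏`; the space with this structure is
the simple affine vertex algebra of level `k`. -/
structure IsStandard {k : ℂ} (B : VertexAlgebra (SimpleQuotient k)) : Prop where
  vac_eq : B.vac = vacuum k
  mode_current : ∀ (x : Sl2) (n : ℤ) (u : SimpleQuotient k),
    B.mode (act k x (-1) (vacuum k)) n u = act k x n u

end AffineSl2

end

/-!
The proof rests on two mechanisms: rigidity of a weight space `V_n^β` that lies within one unit of
the bound `n ≥ (β,β)/2`, and integrability of affine `sl₂` at positive integral level.

**Extremal weight spaces.** Suppose `n - 1 < (β,β)/2`. Every non-zero `v ∈ V_n^β` is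
quasi-primary, because a non-zero `L(1)v` would violate the lower bound on weights, and
self-duality of `V` provides a partner `w ∈ V_n^{-β}` with `v(2n-1)w = c𝟏`, `c ≠ 0`
(`exists_partner`). Since `V_1^0 = H`, the next coefficient `v(2n-2)w` is `cβ`
(`mode_pair_subtop`), so that the two leading coefficients of the operator product are known. The
Borcherds identity then turns suitable modes of `v` and `w` into operators that satisfy an
analogue of `[e, f] = h` along a chain of weight spaces `V_{j²(n-1)+1}^{jβ}` (`chain_commutator`).
Such a chain violates the lower bound for large `j`, hence cannot start (`chain_start_eq_zero`).
For `j = 1` this says that `u ∈ V_n^β` with `w(2n-1)u = 0` is zero, so that `dim V_n^β ≤ 1`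
(`finrank_weightSpace_le_one`); this is the second assertion of the theorem. For `n = 1`, `j = 2`
it says that twice a root is not a root (`weightSpace_two_smul_eq_bot`).

**The affine subalgebra.** Let `e ∈ V_1^α` and `f ∈ V_1^{-α}` with `e(1)f = 𝟏`, where `(α,α) > 0`.
The products of `e`, `f` and `α` are those of affine `sl₂` of level `k = 2/(α,α)`
(`IsRootPair.products`), and the modes of `e`, `kf`, `kα` make `V` a smooth module over the affine
Lie algebra (`IsRootPair.rep`). All real root vectors act locally nilpotently on the weight spaces
of charge in `ℝα`, because `(β,β)/2` grows quadratically along root strings. Hence `k`, the weight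
of `𝟏` for the `sl₂` of the affine simple root, is a natural number (`exists_nat_rootLevel`), and
`V_1^{mα} ≠ 0` implies `2m ∈ ℤ` (`exists_int_of_weightSpace_ne_bot`). Exchanging `α` and `mα`
leaves only `m = ±1/2, ±1, ±2` besides `m = 0`, and twice a root is not a root.

**Simplicity.** It remains to see that the submodule generated by `𝟏` is the irreducible quotient
of the vacuum module. A vacuum module of level `k ∈ ℕ` is graded by words in the lowering
operators `f(0)` and `e(-1)`. A singular vector of charge `j` and degree `d` satisfies
`j(j+1) = (k+2)d` by the Sugawara construction, and its image in an integrable module, if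
non-zero, satisfies `0 ≤ 2j ≤ k`; with `j ≤ d` this forces `d = 0`. So every proper submodule maps to zero
in `V` (`map_eq_zero_of_stable`, `mem_maximalSubmodule_iff`), and the simple quotient embeds into
`V` (`exists_simpleQuotient_map`). Its image is the vertex subalgebra generated by `V_1^{±α}`, and
the vertex algebra structure is transported along this embedding (`pullback`, `exists_affine`).
-/

open scoped TensorProduct

noncomputable section

/-! ### Consequences of the Borcherds identity -/

namespace VertexAlgebra

variable {V : Type*} [AddCommGroup V] [Module ℂ V]

theorem neg_one_pow_mul_choose_neg_one (i : ℕ) :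
    (-1 : ℂ) ^ i * ((Ring.choose (-1 : ℤ) i : ℤ) : ℂ) = 1 := by
  induction i with
  | zero => simp
  | succ i ih =>
    have h := Ring.choose_succ_succ (-1 : ℤ) i
    rw [neg_add_cancel, Ring.choose_zero_succ] at h
    have h' : Ring.choose (-1 : ℤ) (i + 1) = -Ring.choose (-1 : ℤ) i := by linarith
    rw [h', pow_succ]
    push_cast
    linear_combination ih

theorem neg_one_pow_mul_choose_neg_two (i : ℕ) :
    (-1 : ℂ) ^ i * ((Ring.choose (-2 : ℤ) i : ℤ) : ℂ) = i + 1 := by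
  induction i with
  | zero => simp
  | succ i ih =>
    have h := Ring.choose_succ_succ (-2 : ℤ) i
    have h1 := neg_one_pow_mul_choose_neg_one (i + 1)
    rw [show (-2 : ℤ) + 1 = -1 by norm_num] at h
    rw [h] at h1
    push_cast at h1 ⊢
    rw [pow_succ] at h1 ⊢
    linear_combination h1 + ih

theorem finsum_eq_sum_range {M : Type*} [AddCommMonoid M] (f : ℕ → M) (m : ℕ)
    (h : ∀ i, m ≤ i → f i = 0) : ∑ᶠ i, f i = ∑ i ∈ Finset.range m, f i := by
  refine finsum_eq_sum_of_support_subset f fun i hi => ?_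
  by_contra hc
  exact hi (h i (by simpa using hc))

variable (A : VertexAlgebra V)

/-- The Borcherds identity with `r = 0`. -/
theorem commutator (a b c : V) (p q : ℤ) :
    A.mode a p (A.mode b q c) - A.mode b q (A.mode a p c) =
      ∑ᶠ i : ℕ, ((Ring.choose p i : ℤ) : ℂ) • A.mode (A.mode a i b) (p + q - i) c := by
  have h := A.borcherds a b c p q 0
  rw [finsum_eq_sum_range (fun i : ℕ => ((-1 : ℂ) ^ i * ((Ring.choose (0 : ℤ) i : ℤ) : ℂ)) • _) 1]
    at h
  · simpa using h.symm
  · rintro (_ | i) hi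
    · omega
    · simp

/-- The Borcherds identity with `p = 0`. -/
theorem associator (a b c : V) (q r : ℤ) :
    A.mode (A.mode a r b) q c =
      ∑ᶠ i : ℕ, ((-1 : ℂ) ^ i * ((Ring.choose r i : ℤ) : ℂ)) •
        (A.mode a (r - i) (A.mode b (q + i) c)
          - ((-1 : ℂ) ^ r) • A.mode b (q + r - i) (A.mode a i c)) := by
  have h := A.borcherds a b c 0 q r
  rw [finsum_eq_sum_range (fun i : ℕ => ((Ring.choose (0 : ℤ) i : ℤ) : ℂ) • _) 1] at h
  · simpa using h
  · rintro (_ | i) hi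
    · omega
    · simp

theorem mode_comm_mode_vac (a c : V) (p q : ℤ) :
    A.mode a p (A.mode A.vac q c) = A.mode A.vac q (A.mode a p c) := by
  have h := A.commutator a A.vac c p q
  rw [finsum_eq_sum_range _ 0] at h
  · simpa [sub_eq_zero] using h
  · intro i _
    simp [A.mode_vac_of_nonneg a i (by positivity)]

theorem mode_vac_eq (q : ℤ) (a : V) :
    A.mode A.vac q a = A.mode a (-1) (A.mode A.vac q A.vac) := by
  rw [A.mode_comm_mode_vac, A.mode_vac_neg_one]

theorem vac_mode_neg_one (a : V) : A.mode A.vac (-1) a = a := by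
  rw [A.mode_vac_eq, A.mode_vac_neg_one, A.mode_vac_neg_one]

theorem vac_mode_vac_of_lt (m : ℕ) : A.mode A.vac (-2 - m) A.vac = 0 := by
  induction m using Nat.strong_induction_on with
  | _ m ih =>
    have h := A.associator A.vac A.vac A.vac (-2 - m) (-1)
    rw [A.vac_mode_neg_one, finsum_eq_sum_range _ (m + 2), Finset.sum_range_succ,
      Finset.sum_range_succ', Finset.sum_eq_zero] at h
    · simp only [neg_one_pow_mul_choose_neg_one,
        A.mode_vac_of_nonneg _ ((_ : ℕ) : ℤ) (Int.natCast_nonneg _), map_zero, smul_zero,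
        sub_zero, one_smul, zero_add] at h
      rw [show (-2 - (m : ℤ)) + ((m + 1 : ℕ) : ℤ) = -1 by push_cast; ring,
        A.vac_mode_neg_one, show (-1 : ℤ) - ((m + 1 : ℕ) : ℤ) = -2 - m by push_cast; ring] at h
      simpa [A.vac_mode_neg_one] using h
    · intro i hi
      have hi' : i < m := Finset.mem_range.1 hi
      have := ih (m - (i + 1)) (by omega)
      rw [show (-2 : ℤ) - ((m - (i + 1) : ℕ) : ℤ) = -2 - m + ((i + 1 : ℕ) : ℤ) by
        push_cast [Nat.cast_sub (show i + 1 ≤ m by omega)]; ring] at this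
      rw [this, A.mode_vac_of_nonneg _ _ (by positivity)]
      simp
    · intro i hi
      rw [A.mode_vac_of_nonneg _ (-2 - m + (i : ℤ)) (by omega),
        A.mode_vac_of_nonneg _ _ (by positivity)]
      simp

/-- The left vacuum axiom `Y(𝟏, z) = id`. -/
theorem vac_mode (n : ℤ) (a : V) : A.mode A.vac n a = if n = -1 then a else 0 := by
  split_ifs with h
  · rw [h, A.vac_mode_neg_one]
  · rw [A.mode_vac_eq]
    rcases le_or_gt 0 n with h0 | h0
    · rw [A.mode_vac_of_nonneg _ _ h0, map_zero]
    · obtain ⟨m, hm⟩ : ∃ m : ℕ, n = -2 - m := ⟨(-2 - n).toNat, by omega⟩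
      rw [hm, A.vac_mode_vac_of_lt, map_zero]

/-- The translation axiom `Y(Ta, z) = d/dz Y(a, z)`. -/
theorem mode_translate (a c : V) (m : ℤ) :
    A.mode (A.mode a (-2) A.vac) m c = -(m : ℂ) • A.mode a (m - 1) c := by
  rw [A.associator]
  simp only [neg_one_pow_mul_choose_neg_two, A.vac_mode]
  rcases lt_trichotomy m 0 with h | h | h
  · rw [finsum_eq_single _ (-1 - m).toNat]
    · rw [if_pos (by omega), if_neg (by omega),
        show (-2 : ℤ) - ((-1 - m).toNat : ℤ) = m - 1 by omega]
      have : (((-1 - m).toNat : ℕ) : ℂ) = -1 - m := by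
        have : (((-1 - m).toNat : ℕ) : ℤ) = -1 - m := by omega
        exact_mod_cast congrArg (Int.cast : ℤ → ℂ) this
      rw [this]
      simp only [sub_zero, smul_zero]
      module
    · intro i hi
      rw [if_neg (by omega), if_neg (by omega)]
      simp
  · subst h
    rw [finsum_eq_sum_range _ 0]
    · simp
    · intro i _
      rw [if_neg (by omega), if_neg (by omega)]
      simp
  · rw [finsum_eq_single _ (m - 1).toNat]
    · rw [if_neg (by omega), if_pos (by omega), show (((m - 1).toNat : ℕ) : ℤ) = m - 1 by omega]
      have : (((m - 1).toNat : ℕ) : ℂ) = m - 1 := by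
        have : (((m - 1).toNat : ℕ) : ℤ) = m - 1 := by omega
        exact_mod_cast congrArg (Int.cast : ℤ → ℂ) this
      rw [this]
      rw [sub_add_cancel, zpow_neg]
      norm_num
    · intro i hi
      rw [if_neg (by omega), if_neg (by omega)]
      simp

/-- The commutator formula when the operator product has a pole of order at most two with a
scalar leading coefficient. -/
theorem commutator_of_mode_one {a b : V} {κ : ℂ} (h1 : A.mode a 1 b = κ • A.vac)
    (h2 : ∀ n : ℤ, 2 ≤ n → A.mode a n b = 0) (m n : ℤ) (c : V) :
    A.mode a m (A.mode b n c) - A.mode b n (A.mode a m c) =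
      A.mode (A.mode a 0 b) (m + n) c + (if m + n = 0 then (m : ℂ) * κ else 0) • c := by
  rw [A.commutator, finsum_eq_sum_range _ 2]
  · rw [Finset.sum_range_succ, Finset.sum_range_one]
    simp only [Ring.choose_zero_right, Int.cast_one, Nat.cast_zero, sub_zero, one_smul,
      Nat.cast_one, Ring.choose_one_right, h1, map_smul, LinearMap.smul_apply, Pi.smul_apply,
      A.vac_mode]
    congr 1
    by_cases h : m + n = 0
    · simp [h, mul_smul]
    · rw [if_neg (by omega), if_neg h]
      simp
  · intro i hi
    rw [h2 i (by exact_mod_cast hi)]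
    simp

theorem commutator_zero (a b c : V) (n : ℤ) :
    A.mode a 0 (A.mode b n c) - A.mode b n (A.mode a 0 c) = A.mode (A.mode a 0 b) n c := by
  rw [A.commutator, finsum_eq_sum_range _ 1]
  · simp
  · rintro (_ | i) hi
    · omega
    · simp

theorem commutator_one (a b c : V) (n : ℤ) :
    A.mode a 1 (A.mode b n c) - A.mode b n (A.mode a 1 c) =
      A.mode (A.mode a 0 b) (n + 1) c + A.mode (A.mode a 1 b) n c := by
  rw [A.commutator, finsum_eq_sum_range _ 2]
  · rw [Finset.sum_range_succ, Finset.sum_range_one]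
    simp [add_comm]
  · intro i hi
    have : Ring.choose (1 : ℤ) i = 0 := by
      have := Ring.choose_natCast (R := ℤ) 1 i
      rw [Nat.cast_one] at this
      rw [this, Nat.choose_eq_zero_of_lt (by omega), Nat.cast_zero]
    simp [this]

/-- Skew-symmetry of the zeroth product, up to translates that vanish on multiples of `𝟏`. -/
theorem mode_zero_skew {a b : V} {κ : ℂ} (h1 : A.mode a 1 b = κ • A.vac)
    (h2 : ∀ n : ℤ, 2 ≤ n → A.mode a n b = 0) : A.mode b 0 a = -A.mode a 0 b := by
  have h := A.commutator_of_mode_one h1 h2 (-1) 0 A.vac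
  simp only [A.mode_vac_of_nonneg b 0 le_rfl, map_zero, A.mode_vac_neg_one, zero_sub, add_zero]
    at h
  rw [← neg_eq_iff_eq_neg, h]
  simp

theorem mode_one_skew {a b : V} {κ : ℂ} (h1 : A.mode a 1 b = κ • A.vac)
    (h2 : ∀ n : ℤ, 2 ≤ n → A.mode a n b = 0) : A.mode b 1 a = κ • A.vac := by
  have h := A.commutator_of_mode_one h1 h2 (-1) 1 A.vac
  simp only [A.mode_vac_of_nonneg b 1 zero_le_one, map_zero, A.mode_vac_neg_one, zero_sub,
    neg_add_cancel, A.mode_vac_of_nonneg _ 0 le_rfl, zero_add, if_true] at h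
  rw [← neg_inj, h]
  simp

variable {A} {ω : V}

theorem IsConformal.virasoro_zero_mode (hω : A.IsConformal ω) {a : V} {d : ℤ}
    (ha : A.vir ω 0 a = (d : ℂ) • a) (n : ℤ) (c : V) :
    A.vir ω 0 (A.mode a n c) - A.mode a n (A.vir ω 0 c) = ((d : ℂ) - n - 1) • A.mode a n c := by
  have h0 : A.mode ω 0 a = A.mode a (-2) A.vac := by
    simpa [vir] using hω.translation a
  have h1 : A.mode ω 1 a = (d : ℂ) • a := by simpa [vir] using ha
  have h := A.commutator_one ω a c n
  rw [h0, h1, A.mode_translate, add_sub_cancel_right] at h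
  simp only [vir, zero_add]
  rw [h]
  simp only [map_smul, Pi.smul_apply, LinearMap.smul_apply]
  push_cast
  module

end VertexAlgebra

/-! ### Eigenvectors in stable subspaces -/

section Eigen

variable {M : Type*} [AddCommGroup M] [Module ℂ M]

/-- A subspace that is stable under an endomorphism contains the components, with respect to the
eigenspaces, of each of its elements. -/
theorem mem_of_sum_eigenvectors_mem {ι : Type*} {f : Module.End ℂ M} {p : Submodule ℂ M}
    (hp : ∀ x ∈ p, f x ∈ p) {μ : ι → ℂ} (hμ : Function.Injective μ) (s : Finset ι) (x : ι → M)
    (hx : ∀ i, f (x i) = μ i • x i) (hs : ∑ i ∈ s, x i ∈ p) : ∀ i ∈ s, x i ∈ p := by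
  classical
  induction s using Finset.induction_on generalizing x with
  | empty => simp
  | insert a s ha ih =>
    have h1 : ∑ i ∈ s, (μ i - μ a) • x i ∈ p := by
      have h2 := p.sub_mem (hp _ hs) (p.smul_mem (μ a) hs)
      rw [Finset.sum_insert ha, map_add, map_sum, smul_add, hx, Finset.smul_sum,
        add_sub_add_left_eq_sub, ← Finset.sum_sub_distrib] at h2
      simpa only [hx, sub_smul] using h2
    have h3 := ih (fun i => (μ i - μ a) • x i) (fun i => by rw [map_smul, hx, smul_comm]) h1
    have h4 : ∀ i ∈ s, x i ∈ p := fun i hi => by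
      have hne : μ i - μ a ≠ 0 := sub_ne_zero.2 fun h => ha (hμ h ▸ hi)
      simpa [smul_smul, hne] using p.smul_mem (μ i - μ a)⁻¹ (h3 i hi)
    intro i hi
    rcases Finset.mem_insert.1 hi with rfl | hi
    · rw [Finset.sum_insert ha] at hs
      exact (p.add_mem_iff_left (p.sum_mem h4)).1 hs
    · exact h4 i hi

/-- If `M` is spanned by subspaces `Z i` of eigenvectors of `f`, a linear map that does not vanish
on a stable subspace `p` does not vanish on some `p ⊓ Z i`. -/
theorem exists_mem_of_map_ne_zero {N ι : Type*} [AddCommGroup N] [Module ℂ N]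
    {f : Module.End ℂ M} {μ : ι → ℂ} (hμ : Function.Injective μ) {Z : ι → Submodule ℂ M}
    (hZ : ∀ i, ∀ x ∈ Z i, f x = μ i • x) (htop : ⨆ i, Z i = ⊤) {p : Submodule ℂ M}
    (hp : ∀ x ∈ p, f x ∈ p) (ψ : M →ₗ[ℂ] N) {x : M} (hx : x ∈ p) (hψ : ψ x ≠ 0) :
    ∃ i, ∃ y ∈ p, y ∈ Z i ∧ ψ y ≠ 0 := by
  have hx' : x ∈ ⨆ i, Z i := htop ▸ Submodule.mem_top
  obtain ⟨g, hg, hgx⟩ := (Submodule.mem_iSup_iff_exists_finsupp _ x).1 hx'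
  by_contra hc
  push Not at hc
  apply hψ
  rw [← hgx, Finsupp.sum, map_sum]
  refine Finset.sum_eq_zero fun i hi => hc i (g i) ?_ (hg i)
  exact mem_of_sum_eigenvectors_mem hp hμ g.support g (fun i => hZ i _ (hg i))
    (by rwa [← hgx] at hx) i hi

end Eigen

namespace VertexAlgebra

/-! ### Weight spaces -/

variable {V : Type*} [AddCommGroup V] [Module ℂ V] {A : VertexAlgebra V} {ω : V}
  {H : A.HeisenbergSubspace}

theorem mem_weightSpace_iff {n : ℤ} {α : H.carrier} {v : V} :
    v ∈ A.weightSpace ω H n α ↔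
      A.vir ω 0 v = (n : ℂ) • v ∧ ∀ h : H.carrier, A.mode (h : V) 0 v = H.form h α • v := by
  simp [weightSpace, Submodule.mem_iInf]

theorem mode_mem_weightSpace (hω : A.IsConformal ω) {m n : ℤ} {α β : H.carrier} {a b : V}
    (ha : a ∈ A.weightSpace ω H m α) (hb : b ∈ A.weightSpace ω H n β) (k : ℤ) :
    A.mode a k b ∈ A.weightSpace ω H (m + n - k - 1) (α + β) := by
  rw [mem_weightSpace_iff] at ha hb ⊢
  refine ⟨?_, fun h => ?_⟩
  · have := hω.virasoro_zero_mode ha.1 k b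
    rw [hb.1, map_smul, sub_eq_iff_eq_add] at this
    rw [this, ← add_smul]
    push_cast
    ring_nf
  · have := A.commutator_zero h a b k
    rw [ha.2, hb.2, map_smul, sub_eq_iff_eq_add] at this
    rw [this, map_add, add_smul]
    simp

theorem vac_mem_weightSpace : A.vac ∈ A.weightSpace ω H 0 0 := by
  rw [mem_weightSpace_iff]
  simp [vir, A.mode_vac_of_nonneg]

namespace HeisenbergSubspace

theorem eq_of_form_eq (H : A.HeisenbergSubspace) {a b : H.carrier}
    (h : ∀ x, H.form x a = H.form x b) : a = b := by
  rw [← sub_eq_zero]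
  exact H.nondegenerate.2 _ fun x => by simp [h]

end HeisenbergSubspace

namespace AssumptionA

variable (hA : A.AssumptionA ω H)
include hA

theorem eq_zero_of_lt {n : ℤ} {α : H.carrier} {v : V} (hv : v ∈ A.weightSpace ω H n α)
    (h : (n : ℝ) < (H.form α α).re / 2) : v = 0 := by
  rwa [hA.A4 n α h, Submodule.mem_bot] at hv

theorem eq_zero_of_neg {n : ℤ} {v : V} (hv : v ∈ A.weightSpace ω H n 0) (h : n < 0) : v = 0 :=
  hA.eq_zero_of_lt hv (by simpa using h)

theorem exists_smul_vac {v : V} (hv : v ∈ A.weightSpace ω H 0 0) : ∃ c : ℂ, v = c • A.vac := by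
  rw [hA.A5_zero, Submodule.mem_span_singleton] at hv
  exact hv.imp fun _ h => h.symm

theorem mem_weightSpace_one (h : H.carrier) : (h : V) ∈ A.weightSpace ω H 1 0 := by
  rw [hA.A5_one]
  exact h.2

theorem vir_zero_omega : A.vir ω 0 ω = (2 : ℂ) • ω := by
  obtain ⟨c, hc⟩ := hA.conformal.virasoro
  have := hc 0 (-2) A.vac
  simpa [vir, A.mode_vac_of_nonneg, A.mode_vac_neg_one] using this

theorem vir_one_omega : A.vir ω 1 ω = 0 := by
  obtain ⟨c, hc⟩ := hA.conformal.virasoro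
  have := hc 1 (-2) A.vac
  simpa [vir, A.mode_vac_of_nonneg, A.mode_vac_neg_one] using this

end AssumptionA

/-- On a quasi-primary vector the opposite vertex operator has a single term. -/
theorem oppositeMode_of_vir_one_eq_zero {a : V} (ha : A.vir ω 1 a = 0) (n k : ℤ) (u : V) :
    A.oppositeMode ω n a k u = ((-1 : ℂ) ^ n) • A.mode a (2 * n - k - 2) u := by
  rw [oppositeMode, finsum_eq_sum_range _ 1]
  · simp
  · intro i hi
    obtain ⟨j, rfl⟩ := Nat.exists_eq_add_of_le' hi
    simp [pow_succ, ha]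

namespace AssumptionA

variable (hA : A.AssumptionA ω H)
include hA

/-- A non-zero vector `v` of `V_n^β` that is quasi-primary has a partner `w ∈ V_n^{-β}` with
`v(2n-1)w ≠ 0`; this is the non-degeneracy of the pairing given by the self-duality of `V`. -/
theorem exists_partner {n : ℤ} {β : H.carrier} {v : V} (hv : v ∈ A.weightSpace ω H n β)
    (hv0 : v ≠ 0) (hv1 : A.vir ω 1 v = 0) :
    ∃ w ∈ A.weightSpace ω H n (-β), ∃ c : ℂ, c ≠ 0 ∧ A.mode v (2 * n - 1) w = c • A.vac := by
  classical
  obtain ⟨φ, hφ⟩ := hA.A7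
  have hv' := mem_weightSpace_iff.1 hv
  set ψ : Module.Dual ℂ V := (φ v : Module.Dual ℂ V) with hψ
  have hψmode : ∀ y, ψ y =
      ((-1 : ℂ) ^ n) • (φ A.vac : Module.Dual ℂ V) (A.mode v (2 * n - 1) y) := by
    intro y
    have := hφ n v (Module.End.mem_eigenspace_iff.2 hv'.1) (-1) A.vac y
    rw [A.mode_vac_neg_one, oppositeMode_of_vir_one_eq_zero hv1, map_smul] at this
    rw [hψ, this, show 2 * n - -1 - 2 = 2 * n - 1 by ring]
  -- Self-duality makes `ψ` a functional on the dual weight: it sees only `V_n^{-β}`.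
  have hψL : ∀ y, ψ (A.vir ω 0 y) = (n : ℂ) • ψ y := by
    intro y
    have := hφ 2 ω (Module.End.mem_eigenspace_iff.2 (by exact_mod_cast hA.vir_zero_omega)) 1 v y
    rw [oppositeMode_of_vir_one_eq_zero hA.vir_one_omega] at this
    have h2 : A.mode ω 1 v = (n : ℂ) • v := hv'.1
    rw [h2] at this
    simpa [vir] using this.symm
  have hψh : ∀ (h : H.carrier) y, ψ (A.mode (h : V) 0 y) = -(H.form h β • ψ y) := by
    intro h y
    have h1 := hA.A1 h
    have := hφ 1 h (Module.End.mem_eigenspace_iff.2 (by simpa using h1.1)) 0 v y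
    rw [oppositeMode_of_vir_one_eq_zero (h1.2 1 le_rfl), hv'.2] at this
    rw [eq_neg_iff_add_eq_zero]
    simp at this
    rw [hψ, smul_eq_mul, this]
    simp
  obtain ⟨y₀, hy₀⟩ : ∃ y, ψ y ≠ 0 := by
    by_contra hc
    push Not at hc
    have : φ v = 0 := Subtype.ext (LinearMap.ext hc)
    exact hv0 (φ.map_eq_zero_iff.1 this)
  obtain ⟨y₁, hy₁, hy₁'⟩ : ∃ y, A.vir ω 0 y = (n : ℂ) • y ∧ ψ y ≠ 0 := by
    obtain ⟨m, y, -, hy, hy'⟩ := exists_mem_of_map_ne_zero Int.cast_injective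
      (fun _ _ => Module.End.mem_eigenspace_iff.1) hA.conformal.semisimple
      (p := ⊤) (fun _ _ => Submodule.mem_top) ψ (x := y₀) Submodule.mem_top hy₀
    rw [Module.End.mem_eigenspace_iff] at hy
    have := hψL y
    rw [hy, map_smul] at this
    exact ⟨y, by rw [hy, smul_left_injective ℂ hy' this], hy'⟩
  have hcomm : ∀ (h : H.carrier) y, A.vir ω 0 (A.mode (h : V) 0 y) =
      A.mode (h : V) 0 (A.vir ω 0 y) := fun h y => by
    have := hA.conformal.virasoro_zero_mode (d := 1) (by simpa using (hA.A1 h).1) 0 y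
    simpa [sub_eq_zero] using this
  have hcommH : ∀ (h h' : H.carrier) y, A.mode (h : V) 0 (A.mode (h' : V) 0 y) =
      A.mode (h' : V) 0 (A.mode (h : V) 0 y) := fun h h' y => by
    have h1 : A.mode (h : V) 0 (h' : V) = 0 := by
      simpa using (mem_weightSpace_iff.1 (hA.mem_weightSpace_one h')).2 h
    have := A.commutator_zero h h' y 0
    simpa [sub_eq_zero, h1] using this
  -- Project onto the eigenspaces of finitely many of the commuting operators `h(0)`.
  have key : ∀ s : Finset H.carrier, ∃ y, A.vir ω 0 y = (n : ℂ) • y ∧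
      (∀ h ∈ s, A.mode (h : V) 0 y = -(H.form h β) • y) ∧ ψ y ≠ 0 := by
    intro s
    induction s using Finset.induction_on with
    | empty => exact ⟨y₁, hy₁, by simp, hy₁'⟩
    | insert g s hg ih =>
      obtain ⟨y, hyL, hys, hy0⟩ := ih
      let p : Submodule ℂ V := (A.vir ω 0).eigenspace (n : ℂ) ⊓
        ⨅ h ∈ s, (A.mode (h : V) 0).eigenspace (-(H.form h β))
      have hp : ∀ z, z ∈ p ↔ A.vir ω 0 z = (n : ℂ) • z ∧
          ∀ h ∈ s, A.mode (h : V) 0 z = -(H.form h β) • z := by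
        intro z
        simp only [p, Submodule.mem_inf, Submodule.mem_iInf, Module.End.mem_eigenspace_iff]
      obtain ⟨ν, z, hz, hgz, hz0⟩ := exists_mem_of_map_ne_zero Function.injective_id
        (fun _ _ => Module.End.mem_eigenspace_iff.1) (hA.A2 g) (p := p) (fun z hz => by
          rw [hp] at hz ⊢
          refine ⟨by rw [hcomm, hz.1, map_smul], fun h hh => ?_⟩
          rw [hcommH, hz.2 h hh, map_smul]) ψ ((hp y).2 ⟨hyL, hys⟩) hy0
      rw [hp] at hz
      rw [Module.End.mem_eigenspace_iff] at hgz
      refine ⟨z, hz.1, fun h hh => ?_, hz0⟩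
      rcases Finset.mem_insert.1 hh with rfl | hh
      · have := hψh h z
        rw [hgz, map_smul, ← neg_smul] at this
        rw [hgz, smul_left_injective ℂ hz0 this]
      · exact hz.2 h hh
  have hfin : FiniteDimensional ℂ H.carrier := by
    rw [← hA.A5_one]
    exact hA.A6 1 0
  let b := Module.finBasis ℂ H.carrier
  obtain ⟨w, hwL, hwb, hw0⟩ := key (Finset.univ.image b)
  have hw : w ∈ A.weightSpace ω H n (-β) := by
    rw [mem_weightSpace_iff]
    refine ⟨hwL, fun h => ?_⟩
    induction b.mem_span h using Submodule.span_induction with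
    | mem x hx =>
      obtain ⟨i, rfl⟩ := hx
      rw [hwb _ (Finset.mem_image_of_mem _ (Finset.mem_univ i)), map_neg]
    | zero => simp
    | add x y _ _ hx hy =>
      simp only [Submodule.coe_add, map_add, Pi.add_apply, LinearMap.add_apply, add_smul, hx, hy]
    | smul a x _ hx =>
      simp only [Submodule.coe_smul, map_smul, Pi.smul_apply, LinearMap.smul_apply, hx, smul_smul,
        smul_eq_mul]
  refine ⟨w, hw, ?_⟩
  have hmem := mode_mem_weightSpace hA.conformal hv hw (2 * n - 1)
  rw [show n + n - (2 * n - 1) - 1 = 0 by ring, add_neg_cancel] at hmem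
  obtain ⟨c, hc⟩ := hA.exists_smul_vac hmem
  refine ⟨c, ?_, hc⟩
  rintro rfl
  rw [hψmode, hc] at hw0
  simp at hw0

end AssumptionA

end VertexAlgebra

/-! ### Chains of weight vectors and the dimension bound -/

namespace VertexAlgebra

variable {V : Type*} [AddCommGroup V] [Module ℂ V] {A : VertexAlgebra V} {ω : V}
  {H : A.HeisenbergSubspace}

namespace AssumptionA

variable (hA : A.AssumptionA ω H)
include hA

theorem omega_mem_weightSpace : ω ∈ A.weightSpace ω H 2 0 := by
  rw [mem_weightSpace_iff]
  refine ⟨by exact_mod_cast hA.vir_zero_omega, fun h => ?_⟩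
  have h1 := A.commutator ω h A.vac (-1) 0
  rw [finsum_eq_sum_range _ 2, Finset.sum_range_succ, Finset.sum_range_one] at h1
  · have h2 := hA.conformal.translation h
    have h3 := (hA.A1 h).1
    simp only [vir, zero_add, neg_add_cancel] at h2 h3
    simp only [A.mode_vac_of_nonneg _ 0 le_rfl, map_zero, A.mode_vac_neg_one,
      Ring.choose_zero_right, Ring.choose_one_right, Nat.cast_zero, Nat.cast_one, h2, h3] at h1
    simpa [A.mode_vac_neg_one] using h1
  · intro i hi
    have := (hA.A1 h).2 ((i : ℤ) - 1) (by omega)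
    rw [vir, sub_add_cancel] at this
    simp [this]

section Pair

variable {n : ℤ} {β : H.carrier} {v w : V}

theorem mode_one_eq_zero (hn : (n : ℝ) - 1 < (H.form β β).re / 2)
    (hv : v ∈ A.weightSpace ω H n β) (h : H.carrier) : A.mode (h : V) 1 v = 0 := by
  have := mode_mem_weightSpace hA.conformal (hA.mem_weightSpace_one h) hv 1
  rw [zero_add] at this
  refine hA.eq_zero_of_lt this ?_
  push_cast
  linarith

theorem vir_one_eq_zero (hn : (n : ℝ) - 1 < (H.form β β).re / 2)
    (hv : v ∈ A.weightSpace ω H n β) : A.vir ω 1 v = 0 := by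
  have := mode_mem_weightSpace hA.conformal hA.omega_mem_weightSpace hv 2
  rw [zero_add] at this
  refine hA.eq_zero_of_lt this ?_
  push_cast
  linarith

variable (hn : (n : ℝ) - 1 < (H.form β β).re / 2) (hv : v ∈ A.weightSpace ω H n β)
  (hw : w ∈ A.weightSpace ω H n (-β))
include hv hw

theorem mode_pair_mem (k : ℤ) : A.mode v k w ∈ A.weightSpace ω H (2 * n - k - 1) 0 := by
  have := mode_mem_weightSpace hA.conformal hv hw k
  rwa [add_neg_cancel, ← two_mul] at this

theorem mode_pair_eq_zero {k : ℤ} (hk : 2 * n ≤ k) : A.mode v k w = 0 :=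
  hA.eq_zero_of_neg (hA.mode_pair_mem hv hw k) (by omega)

theorem exists_mode_pair_top : ∃ c : ℂ, A.mode v (2 * n - 1) w = c • A.vac := by
  refine hA.exists_smul_vac ?_
  have := hA.mode_pair_mem hv hw (2 * n - 1)
  rwa [show 2 * n - (2 * n - 1) - 1 = 0 by ring] at this

include hn

/-- The next-to-leading coefficient of the operator product `v × w` is determined by the leading
one, because it lies in `V_1^0 = H`. -/
theorem mode_pair_subtop {c : ℂ} (hc : A.mode v (2 * n - 1) w = c • A.vac) :
    A.mode v (2 * n - 2) w = ((c • β : H.carrier) : V) := by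
  have hmem := hA.mode_pair_mem hv hw (2 * n - 2)
  rw [show 2 * n - (2 * n - 2) - 1 = 1 by ring, hA.A5_one] at hmem
  obtain ⟨g, hg⟩ : ∃ g : H.carrier, (g : V) = A.mode v (2 * n - 2) w := ⟨⟨_, hmem⟩, rfl⟩
  rw [← hg]
  congr 1
  refine H.eq_of_form_eq fun h => smul_left_injective ℂ A.vac_ne_zero ?_
  have h1 := A.commutator_one h v w (2 * n - 2)
  rw [hA.mode_one_eq_zero hn hv, hA.mode_one_eq_zero (by simpa using hn) hw,
    (mem_weightSpace_iff.1 hv).2, ← hg, H.mode_one,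
    show 2 * n - 2 + 1 = 2 * n - 1 by ring, map_smul, Pi.smul_apply, LinearMap.smul_apply, hc]
    at h1
  simpa [smul_smul, mul_comm] using h1

/-- The Borcherds identity for `v, w` on a vector `u` of charge `jβ`, with exponents chosen such
that the extreme terms play the part of the relation `[e, f] = h` of `sl₂`. -/
theorem chain_commutator {c : ℂ} (hc : A.mode v (2 * n - 1) w = c • A.vac) {m : ℤ} {j : ℤ} {u : V}
    (hu : u ∈ A.weightSpace ω H m ((j : ℂ) • β))
    (h1 : ∀ i : ℕ, 1 ≤ i →
      A.mode v (-(j - 1) * (2 * n - 2) - i) (A.mode w (j * (2 * n - 2) + i) u) = 0)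
    (h2 : ∀ i : ℕ, 1 ≤ i → A.mode v (-j * (2 * n - 2) + i) u = 0) :
    A.mode v (-(j - 1) * (2 * n - 2)) (A.mode w (j * (2 * n - 2)) u)
      - A.mode w ((j + 1) * (2 * n - 2)) (A.mode v (-j * (2 * n - 2)) u) =
      (c * j * (H.form β β - (2 * n - 2 : ℤ))) • u := by
  have hB := A.borcherds v w u (-j * (2 * n - 2)) (j * (2 * n - 2)) (2 * n - 2)
  have hsign : (-1 : ℂ) ^ (2 * n - 2) = 1 := by
    rw [show 2 * n - 2 = 2 * (n - 1) by ring, zpow_mul]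
    norm_num
  rw [finsum_eq_sum_range _ 2, finsum_eq_sum_range _ 1, Finset.sum_range_succ,
    Finset.sum_range_one, Finset.sum_range_one] at hB
  · simp only [Ring.choose_zero_right, Ring.choose_one_right, Nat.cast_zero, Nat.cast_one,
      add_zero, sub_zero, hsign, pow_zero, Int.cast_one, one_smul, mul_one,
      hA.mode_pair_subtop hn hv hw hc, show 2 * n - 2 + 1 = 2 * n - 1 by ring, hc,
      show -j * (2 * n - 2) + j * (2 * n - 2) = 0 by ring, zero_sub,
      show -j * (2 * n - 2) + (2 * n - 2) = -(j - 1) * (2 * n - 2) by ring,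
      show j * (2 * n - 2) + (2 * n - 2) = (j + 1) * (2 * n - 2) by ring] at hB
    rw [← hB, (mem_weightSpace_iff.1 hu).2]
    simp only [map_smul, LinearMap.smul_apply, Pi.smul_apply, A.vac_mode_neg_one, smul_eq_mul]
    push_cast
    module
  · intro i hi
    have e1 : -j * (2 * n - 2) + (2 * n - 2) - i = -(j - 1) * (2 * n - 2) - i := by ring
    rw [e1, h1 i hi, h2 i hi]
    simp
  · intro i hi
    rw [hA.mode_pair_eq_zero hv hw (by omega)]
    simp

/-- If `v` and `w` pair non-trivially, a vector of charge `j₀β` on which "`e f`" vanishes would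
start an infinite chain of non-zero vectors `u_i` of charge `(j₀ + i)β` and `L(0)`-weight
`(j₀ + i)²(n - 1) + 1`, contrary to the lower bound on weights. -/
theorem chain_start_eq_zero {c : ℂ} (hc0 : c ≠ 0) (hc : A.mode v (2 * n - 1) w = c • A.vac)
    {j₀ : ℕ} (hj₀ : 1 ≤ j₀) {u : V}
    (hu : u ∈ A.weightSpace ω H ((j₀ : ℤ) ^ 2 * (n - 1) + 1) (((j₀ : ℤ) : ℂ) • β))
    (hstart : ∀ i : ℕ,
      A.mode v (-((j₀ : ℤ) - 1) * (2 * n - 2) - i) (A.mode w (j₀ * (2 * n - 2) + i) u) = 0) :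
    u = 0 := by
  have hdlt : ∀ (j : ℤ) (i : ℕ), 1 ≤ i → j ≠ 0 → ∀ x,
      x ∈ A.weightSpace ω H (j ^ 2 * (n - 1) + 1 - i) ((j : ℂ) • β) → x = 0 := by
    intro j i hi hj x hx
    refine hA.eq_zero_of_lt hx ?_
    have h1 : (H.form ((j : ℂ) • β) ((j : ℂ) • β)).re = (j : ℝ) ^ 2 * (H.form β β).re := by
      simp only [map_smul, LinearMap.smul_apply, smul_eq_mul]
      rw [← mul_assoc, ← sq, ← Int.cast_pow, ← Complex.ofReal_intCast, Complex.re_ofReal_mul]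
      push_cast
      ring
    rw [h1]
    push_cast
    have hi' : (1 : ℝ) ≤ i := by exact_mod_cast hi
    have hj' : (0 : ℝ) < (j : ℝ) ^ 2 := by positivity
    nlinarith
  set R : ℤ := 2 * n - 2 with hR
  -- The chain: `U i` has charge `(j₀ + i)β`.
  let U : ℕ → V := fun i => Nat.rec u (fun i x => A.mode v (-((j₀ : ℤ) + i) * R) x) i
  have hU0 : U 0 = u := rfl
  have hUs : ∀ i, U (i + 1) = A.mode v (-((j₀ : ℤ) + i) * R) (U i) := fun i => rfl
  have hUmem : ∀ i : ℕ, U i ∈ A.weightSpace ω H (((j₀ : ℤ) + i) ^ 2 * (n - 1) + 1)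
      ((((j₀ : ℤ) + i : ℤ) : ℂ) • β) := by
    intro i
    induction i with
    | zero => simpa [hU0] using hu
    | succ i ih =>
      have := mode_mem_weightSpace hA.conformal hv ih (-((j₀ : ℤ) + i) * R)
      convert this using 1
      rw [hR]
      congr 1
      · push_cast
        ring
      · push_cast
        module
  have hvU : ∀ i : ℕ, ∀ k : ℕ, 1 ≤ k → A.mode v (-((j₀ : ℤ) + i) * R + k) (U i) = 0 := by
    intro i k hk
    refine hdlt (j₀ + i + 1) k hk (by omega) _ ?_
    convert mode_mem_weightSpace hA.conformal hv (hUmem i) (-((j₀ : ℤ) + i) * R + k) using 1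
    rw [hR]
    congr 1
    · ring
    · push_cast
      module
  have hwU : ∀ i : ℕ, ∀ k : ℕ, 1 ≤ k → A.mode w (((j₀ : ℤ) + (i + 1)) * R + k) (U (i + 1)) = 0 := by
    intro i k hk
    refine hdlt (j₀ + i) k hk (by omega) _ ?_
    convert mode_mem_weightSpace hA.conformal hw (hUmem (i + 1))
      (((j₀ : ℤ) + (i + 1)) * R + k) using 1
    rw [hR]
    congr 1
    · push_cast
      ring
    · push_cast
      module
  set t : ℂ := c * (H.form β β - (R : ℂ)) with ht
  have ht0 : t ≠ 0 := by
    refine mul_ne_zero hc0 fun h => ?_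
    have := congrArg Complex.re h
    rw [Complex.sub_re, Complex.intCast_re, Complex.zero_re, hR] at this
    push_cast at this
    linarith
  -- Lowering `U (i + 1)` returns `U i` up to `-t(j₀ + (j₀ + 1) + ⋯ + (j₀ + i))`, which is not zero.
  have key : ∀ i : ℕ, ∃ q : ℕ, 0 < q ∧
      A.mode w (((j₀ : ℤ) + i + 1) * R) (U (i + 1)) = -((q : ℂ) * t) • U i := by
    intro i
    induction i with
    | zero =>
      refine ⟨j₀, hj₀, ?_⟩
      have h := hA.chain_commutator hn hv hw hc (j := j₀) hu (fun i _ => hstart i)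
        (fun i hi => by simpa [hU0] using hvU 0 i hi)
      have h0 := hstart 0
      simp only [Nat.cast_zero, sub_zero, add_zero] at h0
      rw [h0, zero_sub, neg_eq_iff_eq_neg] at h
      rw [hUs, hU0, Nat.cast_zero, add_zero, h, ht, hR]
      push_cast
      module
    | succ i ih =>
      obtain ⟨q, hq, hqU⟩ := ih
      refine ⟨q + (j₀ + i + 1), by omega, ?_⟩
      have h := hA.chain_commutator hn hv hw hc (j := j₀ + (i + 1)) (hUmem (i + 1))
        (fun k hk => by rw [hwU i k hk, map_zero])
        (fun k hk => by simpa using hvU (i + 1) k hk)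
      rw [← hR, show (j₀ : ℤ) + (i + 1) - 1 = j₀ + i by ring, ← add_assoc, hqU, map_smul,
        ← hUs] at h
      rw [hUs (i + 1)]
      push_cast at h ⊢
      rw [← add_assoc, ← sub_eq_iff_eq_add'.2 (sub_eq_iff_eq_add.1 h), ht]
      module
  have hne : u ≠ 0 → ∀ i, U i ≠ 0 := by
    intro hu0 i
    induction i with
    | zero => exact hu0
    | succ i ih =>
      intro h
      obtain ⟨q, hq, hqU⟩ := key i
      rw [h, map_zero, eq_comm, smul_eq_zero] at hqU
      refine hqU.elim (fun h => ?_) ih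
      have : (q : ℂ) ≠ 0 := by exact_mod_cast hq.ne'
      exact mul_ne_zero this ht0 (neg_eq_zero.1 h)
  by_contra hu0
  obtain ⟨N, hN⟩ := exists_nat_gt (((H.form β β).re / 2 - (n - 1))⁻¹)
  refine hne hu0 N (hA.eq_zero_of_lt (hUmem N) ?_)
  have h1 : (H.form ((((j₀ : ℤ) + N : ℤ) : ℂ) • β) ((((j₀ : ℤ) + N : ℤ) : ℂ) • β)).re =
      (j₀ + N : ℝ) ^ 2 * (H.form β β).re := by
    simp only [map_smul, LinearMap.smul_apply, smul_eq_mul]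
    rw [← mul_assoc, ← sq, ← Int.cast_pow, ← Complex.ofReal_intCast, Complex.re_ofReal_mul]
    push_cast
    ring
  rw [h1]
  push_cast
  have hpos : 0 < (H.form β β).re / 2 - (n - 1) := by linarith
  have hN' : 1 < N * ((H.form β β).re / 2 - (n - 1)) := by
    rwa [← inv_lt_iff_one_lt_mul₀ hpos]
  have hj' : (1 : ℝ) ≤ j₀ := by exact_mod_cast hj₀
  have hN0 : (0 : ℝ) ≤ N := by positivity
  have : (N : ℝ) ≤ (j₀ + N : ℝ) ^ 2 := by nlinarith
  nlinarith [mul_le_mul_of_nonneg_right this hpos.le]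

end Pair

/-- A weight space `V_n^β` with `n - 1 < (β,β)/2` is at most one-dimensional. -/
theorem finrank_weightSpace_le_one {n : ℤ} {β : H.carrier}
    (hn : (n : ℝ) - 1 < (H.form β β).re / 2) : Module.finrank ℂ (A.weightSpace ω H n β) ≤ 1 := by
  by_cases hbot : A.weightSpace ω H n β = ⊥
  · rw [hbot, finrank_bot]
    exact zero_le_one
  obtain ⟨v, hv, hv0⟩ := (Submodule.ne_bot_iff _).1 hbot
  obtain ⟨w, hw, c, hc0, hc⟩ := hA.exists_partner hv hv0 (hA.vir_one_eq_zero hn hv)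
  have hn' : (n : ℝ) - 1 < (H.form (-β) (-β)).re / 2 := by simpa using hn
  have hw' : ∀ u ∈ A.weightSpace ω H n β, u ∈ A.weightSpace ω H n (-(-β)) := by simp
  have hker : ∀ u ∈ A.weightSpace ω H n β, A.mode w (2 * n - 1) u = 0 → u = 0 := by
    intro u hu h0
    refine hA.chain_start_eq_zero hn hv hw hc0 hc le_rfl (by simpa using hu) fun i => ?_
    simp only [Nat.cast_one, one_mul, sub_self, neg_zero, zero_mul, zero_sub]
    suffices A.mode w (2 * n - 2 + i) u = 0 by rw [this, map_zero]
    rcases i with _ | _ | i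
    · have := hA.mode_pair_subtop hn' hw (hw' u hu) (c := 0) (by rw [h0, zero_smul])
      simpa using this
    · simpa [show 2 * n - 2 + 1 = 2 * n - 1 by ring] using h0
    · exact hA.mode_pair_eq_zero hw (hw' u hu) (by push_cast; omega)
  -- `v` spans `V_n^β`: subtract from `u` the multiple of `v` with the same pairing against `w`.
  obtain ⟨d, hd⟩ := hA.exists_mode_pair_top hw (hw' v hv)
  have hd0 : d ≠ 0 := by
    rintro rfl
    exact hv0 (hker v hv (by rw [hd, zero_smul]))
  refine finrank_le_one (⟨v, hv⟩ : A.weightSpace ω H n β) fun ⟨u, hu⟩ => ?_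
  obtain ⟨d', hd'⟩ := hA.exists_mode_pair_top hw (hw' u hu)
  refine ⟨d' / d, Subtype.ext ?_⟩
  have := hker (u - (d' / d) • v) (Submodule.sub_mem _ hu (Submodule.smul_mem _ _ hv)) (by
    rw [map_sub, map_smul, hd, hd', smul_smul, div_mul_cancel₀ _ hd0, sub_self])
  exact (sub_eq_zero.1 this).symm

end AssumptionA

end VertexAlgebra

/-! ### Weights of integrable `sl₂`-modules -/

section Sl2

variable {M : Type*} [AddCommGroup M] [Module ℂ M] {E F D : Module.End ℂ M}

/-- A primitive vector on which the lowering operator is nilpotent has a natural number as its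
weight. -/
theorem exists_nat_weight_of_primitive (hEF : ∀ v, E (F v) = F (E v) + D v)
    (hDF : ∀ v, D (F v) = F (D v) - (2 : ℂ) • F v) {v : M} {l : ℂ} (hv : v ≠ 0) (hE : E v = 0)
    (hD : D v = l • v) {N : ℕ} (hN : (F ^ N) v = 0) : ∃ d : ℕ, l = d := by
  have hs : ∀ n : ℕ, (F ^ (n + 1)) v = F ((F ^ n) v) := fun n => by
    rw [pow_succ', Module.End.mul_apply]
  have hDn : ∀ n : ℕ, D ((F ^ n) v) = (l - 2 * n) • (F ^ n) v := by
    intro n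
    induction n with
    | zero => simpa using hD
    | succ n ih =>
      rw [hs, hDF, ih, map_smul]
      push_cast
      module
  have hEn : ∀ n : ℕ, E ((F ^ (n + 1)) v) = ((n + 1) * (l - n)) • (F ^ n) v := by
    intro n
    induction n with
    | zero =>
      rw [hs, hEF]
      simp [hE, hD]
    | succ n ih =>
      rw [hs, hEF, ih, hDn, map_smul, ← hs]
      push_cast
      module
  obtain ⟨n, hn, hn'⟩ : ∃ n, (F ^ n) v ≠ 0 ∧ (F ^ (n + 1)) v = 0 := by
    by_contra hc
    push Not at hc
    have : ∀ n, (F ^ n) v ≠ 0 := fun n => by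
      induction n with
      | zero => simpa using hv
      | succ n ih => exact hc n ih
    exact this N hN
  have := hEn n
  rw [hn', map_zero, eq_comm, smul_eq_zero, or_iff_left hn, mul_eq_zero,
    or_iff_right (by exact_mod_cast Nat.succ_ne_zero n)] at this
  exact ⟨n, sub_eq_zero.1 this⟩

/-- The weight of `v` is integral, because the last non-zero `E ^ n v` is primitive. -/
theorem exists_int_weight_of_nilpotent (hEF : ∀ v, E (F v) = F (E v) + D v)
    (hDE : ∀ v, D (E v) = E (D v) + (2 : ℂ) • E v)
    (hDF : ∀ v, D (F v) = F (D v) - (2 : ℂ) • F v) {v : M} {l : ℂ} (hv : v ≠ 0)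
    (hD : D v = l • v) {N : ℕ} (hE : (E ^ N) v = 0)
    (hF : ∀ i : ℕ, ∃ N : ℕ, (F ^ N) ((E ^ i) v) = 0) : ∃ d : ℤ, l = d := by
  have hs : ∀ n : ℕ, (E ^ (n + 1)) v = E ((E ^ n) v) := fun n => by
    rw [pow_succ', Module.End.mul_apply]
  have hDn : ∀ n : ℕ, D ((E ^ n) v) = (l + 2 * n) • (E ^ n) v := by
    intro n
    induction n with
    | zero => simpa using hD
    | succ n ih =>
      rw [hs, hDE, ih, map_smul]
      push_cast
      module
  obtain ⟨n, hn, hn'⟩ : ∃ n, (E ^ n) v ≠ 0 ∧ (E ^ (n + 1)) v = 0 := by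
    by_contra hc
    push Not at hc
    have : ∀ n, (E ^ n) v ≠ 0 := fun n => by
      induction n with
      | zero => simpa using hv
      | succ n ih => exact hc n ih
    exact this N hE
  obtain ⟨N', hN'⟩ := hF n
  obtain ⟨d, hd⟩ := exists_nat_weight_of_primitive hEF hDF hn (by rw [← hs, hn']) (hDn n) hN'
  exact ⟨d - 2 * n, by rw [← add_sub_cancel_right l (2 * n), hd]; push_cast; ring⟩

end Sl2

/-! ### Smooth modules over affine `sl₂` and the Sugawara operator -/

/-- Operators `e(n)`, `f(n)`, `h(n)` that make `M` a smooth module of level `k` over the affine Lie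
algebra of `sl₂`: every vector is killed by all modes of sufficiently large index. -/
structure IsAffineTriple {M : Type*} [AddCommGroup M] [Module ℂ M] (e f h : ℤ → Module.End ℂ M)
    (k : ℂ) : Prop where
  ef : ∀ m n v, e m (f n v) = f n (e m v) + h (m + n) v + (if m + n = 0 then (m : ℂ) * k else 0) • v
  he : ∀ m n v, h m (e n v) = e n (h m v) + (2 : ℂ) • e (m + n) v
  hf : ∀ m n v, h m (f n v) = f n (h m v) - (2 : ℂ) • f (m + n) v
  hh : ∀ m n v, h m (h n v) = h n (h m v) + (if m + n = 0 then 2 * (m : ℂ) * k else 0) • v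
  ee : ∀ m n v, e m (e n v) = e n (e m v)
  ff : ∀ m n v, f m (f n v) = f n (f m v)
  smooth : ∀ v, ∃ N : ℕ, ∀ n : ℤ, N ≤ n → e n v = 0 ∧ f n v = 0 ∧ h n v = 0

namespace IsAffineTriple

variable {M : Type*} [AddCommGroup M] [Module ℂ M] {e f h : ℤ → Module.End ℂ M} {k : ℂ}

/-- The contribution of the modes `±(n + 1)` to the Sugawara operator. -/
def sugawaraTerm (e f h : ℤ → Module.End ℂ M) (n : ℕ) : Module.End ℂ M :=
  (2 : ℂ) • (e (-(n + 1)) * f (n + 1)) + (2 : ℂ) • (f (-(n + 1)) * e (n + 1))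
    + h (-(n + 1)) * h (n + 1)

/-- The Sugawara operator `∑_n ∑_a : u^a(-n) u_a(n) :`, without the modes of absolute value greater
than `N`; the bases `u^a`, `u_a` of `sl₂` are dual with respect to the trace form. -/
def sugawaraTrunc (e f h : ℤ → Module.End ℂ M) (N : ℕ) : Module.End ℂ M :=
  e 0 * f 0 + f 0 * e 0 + (1 / 2 : ℂ) • (h 0 * h 0) + ∑ n ∈ Finset.range N, sugawaraTerm e f h n

theorem sugawaraTerm_apply (n : ℕ) (v : M) : sugawaraTerm e f h n v =
    (2 : ℂ) • e (-(n + 1)) (f (n + 1) v) + (2 : ℂ) • f (-(n + 1)) (e (n + 1) v)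
      + h (-(n + 1)) (h (n + 1) v) := rfl

theorem sugawaraTrunc_apply (N : ℕ) (v : M) : sugawaraTrunc e f h N v =
    e 0 (f 0 v) + f 0 (e 0 v) + (1 / 2 : ℂ) • h 0 (h 0 v)
      + ∑ n ∈ Finset.range N, sugawaraTerm e f h n v := by
  simp [sugawaraTrunc, LinearMap.sum_apply]

theorem sugawaraTrunc_eq_of_le {v : M} {N N' : ℕ} (hNN' : N ≤ N')
    (hN : ∀ n : ℤ, N ≤ n → e n v = 0 ∧ f n v = 0 ∧ h n v = 0) :
    sugawaraTrunc e f h N' v = sugawaraTrunc e f h N v := by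
  rw [sugawaraTrunc_apply, sugawaraTrunc_apply]
  congr 1
  refine (Finset.sum_subset (Finset.range_subset_range.2 hNN') fun n _ hn => ?_).symm
  rw [Finset.mem_range, not_lt] at hn
  obtain ⟨h1, h2, h3⟩ := hN (n + 1) (by omega)
  rw [sugawaraTerm_apply, h1, h2, h3]
  simp

variable (hT : IsAffineTriple e f h k)

/-- The Sugawara operator of a smooth module; for `k ≠ -2` it is `2(k + 2)` times the conformal
grading operator. -/
def sugawara : Module.End ℂ M where
  toFun v := sugawaraTrunc e f h (hT.smooth v).choose v
  map_add' v w := by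
    have h1 := (hT.smooth v).choose_spec
    have h2 := (hT.smooth w).choose_spec
    have h3 := (hT.smooth (v + w)).choose_spec
    set a := (hT.smooth v).choose
    set b := (hT.smooth w).choose
    set c := (hT.smooth (v + w)).choose
    rw [← sugawaraTrunc_eq_of_le (show a ≤ a + b + c by omega) h1,
      ← sugawaraTrunc_eq_of_le (show b ≤ a + b + c by omega) h2,
      ← sugawaraTrunc_eq_of_le (show c ≤ a + b + c by omega) h3, map_add]
  map_smul' r v := by
    have h1 := (hT.smooth v).choose_spec
    have h2 := (hT.smooth (r • v)).choose_spec
    set a := (hT.smooth v).choose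
    set b := (hT.smooth (r • v)).choose
    rw [← sugawaraTrunc_eq_of_le (show a ≤ a + b by omega) h1,
      ← sugawaraTrunc_eq_of_le (show b ≤ a + b by omega) h2, map_smul, RingHom.id_apply]

theorem sugawara_eq {v : M} {N : ℕ}
    (hN : ∀ n : ℤ, N ≤ n → e n v = 0 ∧ f n v = 0 ∧ h n v = 0) :
    hT.sugawara v = sugawaraTrunc e f h N v := by
  have h1 := (hT.smooth v).choose_spec
  change sugawaraTrunc e f h (hT.smooth v).choose v = _
  set a := (hT.smooth v).choose
  rw [← sugawaraTrunc_eq_of_le (show a ≤ a + N by omega) h1,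
    ← sugawaraTrunc_eq_of_le (show N ≤ a + N by omega) hN]

include hT

theorem sugawara_f_zero (v : M) : hT.sugawara (f 0 v) = f 0 (hT.sugawara v) := by
  obtain ⟨a, ha⟩ := hT.smooth v
  obtain ⟨b, hb⟩ := hT.smooth (f 0 v)
  rw [hT.sugawara_eq (N := a + b) fun n hn => ha n (by push_cast at hn; omega),
    hT.sugawara_eq (N := a + b) fun n hn => hb n (by push_cast at hn; omega),
    sugawaraTrunc_apply, sugawaraTrunc_apply, map_add, map_sum]
  congr 1
  · simp only [map_add, map_smul, hT.ef, hT.hf, map_sub, add_zero, if_true, Int.cast_zero,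
      zero_mul, zero_smul]
    module
  · refine Finset.sum_congr rfl fun n _ => ?_
    have hn : ¬((n : ℤ) + 1 = 0) := by omega
    have hn' : ¬(-((n : ℤ) + 1) = 0) := by omega
    simp only [sugawaraTerm_apply, map_add, map_smul, hT.ff _ 0, hT.ef _ 0, hT.hf _ 0, map_sub,
      if_neg hn, if_neg hn', add_zero, zero_smul]
    module

theorem sugawara_e_neg_one (v : M) :
    hT.sugawara (e (-1) v) = e (-1) (hT.sugawara v) + (2 * (k + 2)) • e (-1) v := by
  obtain ⟨a, ha⟩ := hT.smooth v
  obtain ⟨b, hb⟩ := hT.smooth (e (-1) v)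
  rw [hT.sugawara_eq (N := a + b + 1) fun n hn => ha n (by push_cast at hn; omega),
    hT.sugawara_eq (N := a + b + 1) fun n hn => hb n (by push_cast at hn; omega),
    sugawaraTrunc_apply, sugawaraTrunc_apply, map_add, map_sum]
  -- The commutators of the individual terms telescope.
  let B : ℕ → M := fun n => (2 : ℂ) • e (-(n + 1)) (h n v) - (2 : ℂ) • h (-(n + 1)) (e n v)
  have hterm : ∀ n : ℕ, sugawaraTerm e f h n (e (-1) v) = e (-1) (sugawaraTerm e f h n v)
      + (B (n + 1) - B n) + (if n = 0 then 2 * k else 0) • e (-1) v := by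
    intro n
    have h1 : f (n + 1) (e (-1) v) = e (-1) (f (n + 1) v) - h n v
        - (if n = 0 then -k else 0) • v := by
      rw [hT.ef, show -1 + ((n : ℤ) + 1) = n by ring]
      by_cases hn : n = 0
      · subst hn
        simp only [Nat.cast_zero, if_true]
        push_cast
        module
      · rw [if_neg (by omega), if_neg hn]
        module
    have h2 : f (-(n + 1)) (e (-1) (e (n + 1) v)) =
        e (-1) (f (-(n + 1)) (e (n + 1) v)) - h (-(((n + 1 : ℕ) : ℤ) + 1)) (e (n + 1) v) := by
      rw [hT.ef, show -1 + (-((n : ℤ) + 1)) = -(((n + 1 : ℕ) : ℤ) + 1) by push_cast; ring,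
        if_neg (by omega)]
      simp
    have h3 : h (-(n + 1)) (e (-1) (h (n + 1) v)) = e (-1) (h (-(n + 1)) (h (n + 1) v))
        + (2 : ℂ) • e (-(((n + 1 : ℕ) : ℤ) + 1)) (h (n + 1) v) := by
      rw [hT.he, show -((n : ℤ) + 1) + -1 = -(((n + 1 : ℕ) : ℤ) + 1) by push_cast; ring]
    have h4 : h (n + 1) (e (-1) v) = e (-1) (h (n + 1) v) + (2 : ℂ) • e n v := by
      rw [hT.he, show (n : ℤ) + 1 + -1 = n by ring]
    rw [sugawaraTerm_apply, sugawaraTerm_apply, h1, hT.ee _ (-1), h4]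
    simp only [map_add, map_sub, map_smul, hT.ee _ (-1) (f _ _), h2, h3, B]
    by_cases hn : n = 0
    · subst hn
      simp only [if_true]
      push_cast
      module
    · simp only [hn, if_false]
      push_cast
      module
  have hB : B (a + b + 1) = 0 := by
    obtain ⟨h1, -, h3⟩ := ha (a + b + 1) (by omega)
    simp only [B]
    push_cast
    rw [h1, h3]
    simp
  rw [Finset.sum_congr rfl fun n _ => hterm n, Finset.sum_add_distrib, Finset.sum_add_distrib,
    Finset.sum_range_sub, ← Finset.sum_smul, Finset.sum_ite_eq' _ 0,
    if_pos (Finset.mem_range.2 (by omega)), hB]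
  have h1 : f 0 (e (-1) v) = e (-1) (f 0 v) - h (-1) v := by
    rw [hT.ef]
    simp
  have h2 : f 0 (e (-1) (e 0 v)) = e (-1) (f 0 (e 0 v)) - h (-1) (e 0 v) := by
    rw [hT.ef]
    simp
  have h3 : h (-1) (e 0 v) = e 0 (h (-1) v) + (2 : ℂ) • e (-1) v := by
    rw [hT.he]
    simp
  have h4 : ∀ w, h 0 (e (-1) w) = e (-1) (h 0 w) + (2 : ℂ) • e (-1) w := fun w => by
    rw [hT.he]
    simp
  simp only [B, h1, hT.ee 0 (-1), h2, h4, map_add, map_sub, map_smul, Nat.cast_zero, zero_add, h3]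
  module

end IsAffineTriple

/-! ### Words in the Chevalley lowering operators -/

namespace IsAffineTriple

variable {M : Type*} [AddCommGroup M] [Module ℂ M] {e f h : ℤ → Module.End ℂ M} {k : ℂ}

/-- The vectors obtained from `v₀` by applying the Chevalley lowering operators `f(0)` and `e(-1)`
of the affine Lie algebra, with their bidegree: `d` counts the `e(-1)`, and `2j` is the weight with
respect to `h(0)`. -/
inductive IsWord (e f : ℤ → Module.End ℂ M) (v₀ : M) : ℤ → ℤ → M → Prop
  | vac : IsWord e f v₀ 0 0 v₀
  | f_zero {d j : ℤ} {w : M} : IsWord e f v₀ d j w → IsWord e f v₀ d (j - 1) (f 0 w)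
  | e_neg_one {d j : ℤ} {w : M} : IsWord e f v₀ d j w → IsWord e f v₀ (d + 1) (j + 1) (e (-1) w)

/-- The span of the words of bidegree `(d, j)`. -/
def wordSpan (e f : ℤ → Module.End ℂ M) (v₀ : M) (d j : ℤ) : Submodule ℂ M :=
  Submodule.span ℂ {w | IsWord e f v₀ d j w}

/-- `v₀` is annihilated by all modes of non-negative index. -/
def IsVacuum (e f h : ℤ → Module.End ℂ M) (v₀ : M) : Prop :=
  ∀ n : ℤ, 0 ≤ n → e n v₀ = 0 ∧ f n v₀ = 0 ∧ h n v₀ = 0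

variable {v₀ : M}

theorem wordSpan_map {d j d' j' : ℤ} {T : Module.End ℂ M}
    (hT : ∀ w, IsWord e f v₀ d j w → T w ∈ wordSpan e f v₀ d' j') {w : M}
    (hw : w ∈ wordSpan e f v₀ d j) : T w ∈ wordSpan e f v₀ d' j' :=
  (Submodule.span_le.2 hT : _ ≤ (wordSpan e f v₀ d' j').comap T) hw

theorem f_zero_mem_wordSpan {d j : ℤ} {w : M} (hw : w ∈ wordSpan e f v₀ d j) :
    f 0 w ∈ wordSpan e f v₀ d (j - 1) :=
  wordSpan_map (fun _ hw => Submodule.subset_span hw.f_zero) hw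

theorem e_neg_one_mem_wordSpan {d j : ℤ} {w : M} (hw : w ∈ wordSpan e f v₀ d j) :
    e (-1) w ∈ wordSpan e f v₀ (d + 1) (j + 1) :=
  wordSpan_map (fun _ hw => Submodule.subset_span hw.e_neg_one) hw

theorem IsWord.zero_le {d j : ℤ} {w : M} (hw : IsWord e f v₀ d j w) : 0 ≤ d := by
  induction hw <;> omega

theorem IsWord.le {d j : ℤ} {w : M} (hw : IsWord e f v₀ d j w) : j ≤ d := by
  induction hw <;> omega

theorem zero_le_of_mem_wordSpan {d j : ℤ} {w : M} (hw : w ∈ wordSpan e f v₀ d j) (hw0 : w ≠ 0) :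
    0 ≤ d ∧ j ≤ d := by
  by_contra hc
  refine hw0 ?_
  have : {w | IsWord e f v₀ d j w} = ∅ :=
    Set.eq_empty_of_forall_notMem fun w hw => hc ⟨hw.zero_le, hw.le⟩
  rwa [wordSpan, this, Submodule.span_empty, Submodule.mem_bot] at hw

theorem mem_span_vac_of_mem_wordSpan_zero (hv₀ : IsVacuum e f h v₀) {j : ℤ} {w : M}
    (hw : w ∈ wordSpan e f v₀ 0 j) : w ∈ Submodule.span ℂ {v₀} := by
  refine (Submodule.span_le.2 ?_ : wordSpan e f v₀ 0 j ≤ _) hw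
  suffices ∀ d j w, IsWord e f v₀ d j w → d = 0 → w ∈ Submodule.span ℂ {v₀} from
    fun w hw => this 0 j w hw rfl
  intro d j w hw hd
  induction hw with
  | vac => exact Submodule.mem_span_singleton_self v₀
  | f_zero hw ih =>
    obtain ⟨c, rfl⟩ := Submodule.mem_span_singleton.1 (ih hd)
    rw [map_smul, (hv₀ 0 le_rfl).2.1, smul_zero]
    exact Submodule.zero_mem _
  | e_neg_one hw ih =>
    have := hw.zero_le
    omega

variable (hT : IsAffineTriple e f h k)

theorem sugawara_vac (hv₀ : IsVacuum e f h v₀) : hT.sugawara v₀ = 0 := by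
  rw [hT.sugawara_eq (N := 0) (by exact_mod_cast hv₀), sugawaraTrunc_apply,
    (hv₀ 0 le_rfl).1, (hv₀ 0 le_rfl).2.1, (hv₀ 0 le_rfl).2.2]
  simp

theorem sugawara_wordSpan (hv₀ : IsVacuum e f h v₀) {d j : ℤ} {w : M}
    (hw : w ∈ wordSpan e f v₀ d j) : hT.sugawara w = (2 * (k + 2) * d) • w := by
  rw [← Module.End.mem_eigenspace_iff]
  refine (Submodule.span_le.2 fun u hu => ?_ : wordSpan e f v₀ d j ≤ _) hw
  clear hw
  rw [SetLike.mem_coe, Module.End.mem_eigenspace_iff]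
  induction hu with
  | vac => simp [hT.sugawara_vac hv₀]
  | f_zero hw ih => rw [hT.sugawara_f_zero, ih, map_smul]
  | e_neg_one hw ih =>
    rw [hT.sugawara_e_neg_one, ih, map_smul]
    push_cast
    module

include hT

theorem h_zero_wordSpan (hv₀ : IsVacuum e f h v₀) {d j : ℤ} {w : M}
    (hw : w ∈ wordSpan e f v₀ d j) : h 0 w = (2 * (j : ℂ)) • w := by
  rw [← Module.End.mem_eigenspace_iff]
  refine (Submodule.span_le.2 fun u hu => ?_ : wordSpan e f v₀ d j ≤ _) hw
  clear hw
  rw [SetLike.mem_coe, Module.End.mem_eigenspace_iff]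
  induction hu with
  | vac => simp [(hv₀ 0 le_rfl).2.2]
  | f_zero hw ih =>
    rw [hT.hf, ih, map_smul]
    push_cast
    module
  | e_neg_one hw ih =>
    rw [hT.he, ih, map_smul]
    push_cast
    module

theorem e_zero_mem_wordSpan (hv₀ : IsVacuum e f h v₀) {d j : ℤ} {w : M}
    (hw : w ∈ wordSpan e f v₀ d j) : e 0 w ∈ wordSpan e f v₀ d (j + 1) := by
  refine wordSpan_map (fun u hu => ?_) hw
  clear hw
  induction hu with
  | vac => simp [(hv₀ 0 le_rfl).1]
  | @f_zero d j w hw ih =>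
    rw [hT.ef]
    simp only [Int.cast_zero, zero_mul, ite_self, zero_smul, add_zero]
    rw [hT.h_zero_wordSpan hv₀ (Submodule.subset_span hw), sub_add_cancel]
    refine add_mem ?_ (Submodule.smul_mem _ _ (Submodule.subset_span hw))
    simpa using f_zero_mem_wordSpan ih
  | e_neg_one hw ih =>
    rw [hT.ee]
    exact e_neg_one_mem_wordSpan ih

theorem f_one_mem_wordSpan (hv₀ : IsVacuum e f h v₀) {d j : ℤ} {w : M}
    (hw : w ∈ wordSpan e f v₀ d j) : f 1 w ∈ wordSpan e f v₀ (d - 1) (j - 1) := by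
  refine wordSpan_map (fun u hu => ?_) hw
  clear hw
  induction hu with
  | vac => simp [(hv₀ 1 zero_le_one).2.1]
  | f_zero hw ih =>
    rw [hT.ff]
    exact f_zero_mem_wordSpan ih
  | @e_neg_one d j w hw ih =>
    have h1 := hT.ef (-1) 1 w
    rw [add_assoc, eq_comm, ← eq_sub_iff_add_eq] at h1
    rw [h1, neg_add_cancel, if_pos rfl, hT.h_zero_wordSpan hv₀ (Submodule.subset_span hw),
      add_sub_cancel_right, add_sub_cancel_right]
    refine sub_mem ?_ (add_mem (Submodule.smul_mem _ _ (Submodule.subset_span hw))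
      (Submodule.smul_mem _ _ (Submodule.subset_span hw)))
    simpa using e_neg_one_mem_wordSpan ih

/-- The Chevalley generators generate the affine Lie algebra: a subspace that they stabilise is
stable under all modes. -/
theorem mem_of_chevalley_mem {Z : Submodule ℂ M} (he0 : ∀ w ∈ Z, e 0 w ∈ Z)
    (hf0 : ∀ w ∈ Z, f 0 w ∈ Z) (he1 : ∀ w ∈ Z, e (-1) w ∈ Z) (hf1 : ∀ w ∈ Z, f 1 w ∈ Z)
    (n : ℤ) : ∀ w ∈ Z, e n w ∈ Z ∧ f n w ∈ Z ∧ h n w ∈ Z := by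
  have hcomm : ∀ m n, (∀ w ∈ Z, e m w ∈ Z) → (∀ w ∈ Z, f n w ∈ Z) → ∀ w ∈ Z, h (m + n) w ∈ Z := by
    intro m n hm hn w hw
    have h1 := hT.ef m n w
    rw [add_assoc, ← sub_eq_iff_eq_add', eq_comm, ← eq_sub_iff_add_eq] at h1
    rw [h1]
    exact sub_mem (sub_mem (hm _ (hn _ hw)) (hn _ (hm _ hw))) (Z.smul_mem _ hw)
  have hestep : ∀ m n, (∀ w ∈ Z, h m w ∈ Z) → (∀ w ∈ Z, e n w ∈ Z) → ∀ w ∈ Z, e (m + n) w ∈ Z := by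
    intro m n hm hn w hw
    have h1 : e (m + n) w = (1 / 2 : ℂ) • (h m (e n w) - e n (h m w)) := by
      rw [hT.he]
      module
    rw [h1]
    exact Z.smul_mem _ (sub_mem (hm _ (hn _ hw)) (hn _ (hm _ hw)))
  have hfstep : ∀ m n, (∀ w ∈ Z, h m w ∈ Z) → (∀ w ∈ Z, f n w ∈ Z) → ∀ w ∈ Z, f (m + n) w ∈ Z := by
    intro m n hm hn w hw
    have h1 : f (m + n) w = (-1 / 2 : ℂ) • (h m (f n w) - f n (h m w)) := by
      rw [hT.hf]
      module
    rw [h1]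
    exact Z.smul_mem _ (sub_mem (hm _ (hn _ hw)) (hn _ (hm _ hw)))
  have hp : ∀ w ∈ Z, h 1 w ∈ Z := by simpa using hcomm 0 1 he0 hf1
  have hm : ∀ w ∈ Z, h (-1) w ∈ Z := by simpa using hcomm (-1) 0 he1 hf0
  have hef : (∀ w ∈ Z, e n w ∈ Z) ∧ ∀ w ∈ Z, f n w ∈ Z := by
    induction n using Int.induction_on with
    | zero => exact ⟨he0, hf0⟩
    | succ i ih =>
      rw [add_comm]
      exact ⟨hestep 1 i hp ih.1, hfstep 1 i hp ih.2⟩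
    | pred i ih =>
      rw [sub_eq_add_neg, add_comm]
      exact ⟨hestep (-1) (-i) hm ih.1, hfstep (-1) (-i) hm ih.2⟩
  refine fun w hw => ⟨hef.1 w hw, hef.2 w hw, ?_⟩
  simpa using hcomm n 0 hef.1 hf0 w hw

/-- The words span a subspace that is stable under all modes. -/
theorem iSup_wordSpan_stable (hv₀ : IsVacuum e f h v₀) (n : ℤ) (w : M)
    (hw : w ∈ ⨆ p : ℤ × ℤ, wordSpan e f v₀ p.1 p.2) :
    e n w ∈ (⨆ p : ℤ × ℤ, wordSpan e f v₀ p.1 p.2) ∧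
      f n w ∈ (⨆ p : ℤ × ℤ, wordSpan e f v₀ p.1 p.2) ∧
      h n w ∈ (⨆ p : ℤ × ℤ, wordSpan e f v₀ p.1 p.2) := by
  have key : ∀ T : Module.End ℂ M, (∀ d j, ∃ p : ℤ × ℤ, ∀ x ∈ wordSpan e f v₀ d j,
      T x ∈ wordSpan e f v₀ p.1 p.2) → ∀ w ∈ ⨆ p : ℤ × ℤ, wordSpan e f v₀ p.1 p.2,
      T w ∈ ⨆ p : ℤ × ℤ, wordSpan e f v₀ p.1 p.2 := by
    intro T hTw w hw
    refine (iSup_le fun p x hx => ?_ : (⨆ p : ℤ × ℤ, wordSpan e f v₀ p.1 p.2) ≤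
      (⨆ p : ℤ × ℤ, wordSpan e f v₀ p.1 p.2).comap T) hw
    obtain ⟨q, hq⟩ := hTw p.1 p.2
    exact (le_iSup (fun p : ℤ × ℤ => wordSpan e f v₀ p.1 p.2) q) (hq x hx)
  exact hT.mem_of_chevalley_mem
    (key _ fun d j => ⟨(d, j + 1), fun x hx => hT.e_zero_mem_wordSpan hv₀ hx⟩)
    (key _ fun d j => ⟨(d, j - 1), fun x hx => f_zero_mem_wordSpan hx⟩)
    (key _ fun d j => ⟨(d + 1, j + 1), fun x hx => e_neg_one_mem_wordSpan hx⟩)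
    (key _ fun d j => ⟨(d - 1, j - 1), fun x hx => hT.f_one_mem_wordSpan hv₀ hx⟩) n w hw

/-- A vector killed by the Chevalley raising operators `e(0)` and `f(1)` is killed by all modes of
positive index, and the Sugawara operator acts on it as the Casimir operator of `sl₂`. -/
theorem sugawara_singular {v : M} (he : e 0 v = 0) (hf : f 1 v = 0) :
    hT.sugawara v = h 0 v + (1 / 2 : ℂ) • h 0 (h 0 v) := by
  have h1 : h 1 v = 0 := by
    have := hT.ef 0 1 v
    rw [hf, he] at this
    simpa using this.symm
  have hef : ∀ n : ℕ, e n v = 0 ∧ f (n + 1) v = 0 := by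
    intro n
    induction n with
    | zero => exact ⟨by simpa using he, by simpa using hf⟩
    | succ n ih =>
      have h2 := hT.he 1 n v
      have h3 := hT.hf 1 (n + 1) v
      rw [h1, ih.1] at h2
      rw [h1, ih.2] at h3
      rw [add_comm (1 : ℤ)] at h2 h3
      exact ⟨by simpa using h2.symm, by simpa using h3⟩
  have hh : ∀ n : ℕ, h (n + 1) v = 0 := by
    intro n
    have := hT.ef 0 (n + 1) v
    rw [(hef n).2, he] at this
    simpa using this.symm
  rw [hT.sugawara_eq (N := 1), sugawaraTrunc_apply, Finset.sum_range_one, sugawaraTerm_apply,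
    hT.ef, he]
  · have h2 := (hef 0).2
    have h3 := (hef 1).1
    have h4 := hh 0
    simp only [Nat.cast_zero, Nat.cast_one, zero_add] at h2 h3 h4
    simp [h2, h3, h4]
  · intro n hn
    obtain ⟨m, rfl⟩ : ∃ m : ℕ, n = m + 1 := ⟨(n - 1).toNat, by push_cast at hn; omega⟩
    refine ⟨?_, (hef m).2, hh m⟩
    exact_mod_cast (hef (m + 1)).1

end IsAffineTriple

namespace IsAffineTriple

variable {M M' : Type*} [AddCommGroup M] [Module ℂ M] [AddCommGroup M'] [Module ℂ M']
  {e f h : ℤ → Module.End ℂ M} {e' f' h' : ℤ → Module.End ℂ M'} {k : ℂ} {v₀ : M}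

theorem map_sugawara (hT : IsAffineTriple e f h k) (hT' : IsAffineTriple e' f' h' k)
    {π : M →ₗ[ℂ] M'} (hπ : ∀ n v, π (e n v) = e' n (π v) ∧ π (f n v) = f' n (π v) ∧
      π (h n v) = h' n (π v)) (v : M) : π (hT.sugawara v) = hT'.sugawara (π v) := by
  obtain ⟨a, ha⟩ := hT.smooth v
  obtain ⟨b, hb⟩ := hT'.smooth (π v)
  rw [hT.sugawara_eq (N := a + b) fun n hn => ha n (by push_cast at hn; omega),
    hT'.sugawara_eq (N := a + b) fun n hn => hb n (by push_cast at hn; omega)]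
  simp only [sugawaraTrunc_apply, sugawaraTerm_apply, map_add, map_sum, map_smul, (hπ _ _).1,
    (hπ _ _).2.1, (hπ _ _).2.2]

theorem sugawara_mem (hT : IsAffineTriple e f h k) {N : Submodule ℂ M}
    (hN : ∀ n, ∀ x ∈ N, e n x ∈ N ∧ f n x ∈ N ∧ h n x ∈ N) {x : M} (hx : x ∈ N) :
    hT.sugawara x ∈ N := by
  have he : ∀ n, ∀ x ∈ N, e n x ∈ N := fun n x hx => (hN n x hx).1
  have hf : ∀ n, ∀ x ∈ N, f n x ∈ N := fun n x hx => (hN n x hx).2.1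
  have hh : ∀ n, ∀ x ∈ N, h n x ∈ N := fun n x hx => (hN n x hx).2.2
  obtain ⟨a, ha⟩ := hT.smooth x
  rw [hT.sugawara_eq ha, sugawaraTrunc_apply]
  refine add_mem (add_mem (add_mem (he _ _ (hf _ _ hx)) (hf _ _ (he _ _ hx)))
    (N.smul_mem _ (hh _ _ (hh _ _ hx)))) (N.sum_mem fun n _ => ?_)
  rw [sugawaraTerm_apply]
  exact add_mem (add_mem (N.smul_mem _ (he _ _ (hf _ _ hx))) (N.smul_mem _ (hf _ _ (he _ _ hx))))
    (hh _ _ (hh _ _ hx))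

/-- A highest weight module over affine `sl₂` of level `k ∈ ℕ` with highest weight vector of
`sl₂`-weight `0` that is integrable is irreducible, in the following form: a map `π` from the
highest weight module `M` to a module on which `f(0)` and `e(-1)` act nilpotently on the image of
every word kills every submodule of `M` that does not contain the highest weight vector.

A singular vector of bidegree `(d, j)` in the image of a submodule has Sugawara eigenvalue
`2j(j + 1) = 2(k + 2)d`, and integrability gives `0 ≤ 2j ≤ k`; with `j ≤ d` this forces `d = 0`. -/
theorem map_eq_zero_of_stable (hT : IsAffineTriple e f h k) (hT' : IsAffineTriple e' f' h' k)
    {π : M →ₗ[ℂ] M'} (hπ : ∀ n v, π (e n v) = e' n (π v) ∧ π (f n v) = f' n (π v) ∧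
      π (h n v) = h' n (π v)) {K : ℕ} (hk : k = K) (hv₀ : IsVacuum e f h v₀)
    (htop : ⨆ p : ℤ × ℤ, wordSpan e f v₀ p.1 p.2 = ⊤)
    (hnf : ∀ d j, ∀ x ∈ wordSpan e f v₀ d j, ∃ N : ℕ, (f' 0 ^ N) (π x) = 0)
    (hne : ∀ d j, ∀ x ∈ wordSpan e f v₀ d j, ∃ N : ℕ, (e' (-1) ^ N) (π x) = 0)
    {N : Submodule ℂ M} (hN : ∀ n, ∀ x ∈ N, e n x ∈ N ∧ f n x ∈ N ∧ h n x ∈ N) (hv₀N : v₀ ∉ N) :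
    ∀ x ∈ N, π x = 0 := by
  have hk2 : k + 2 ≠ 0 := by
    rw [hk]
    exact_mod_cast Nat.succ_ne_zero (K + 1)
  -- It suffices to treat elements of the `wordSpan`, as these are the joint eigenspaces of the
  -- Sugawara operator and `h(0)`, that is, the eigenspaces of the following single operator.
  let T : Module.End ℂ M := hT.sugawara + ((k + 2) * Complex.I) • h 0
  let μ : ℤ × ℤ → ℂ := fun p => 2 * (k + 2) * (p.1 + p.2 * Complex.I)
  have hμ : Function.Injective μ := by
    intro p q hpq
    have h1 := mul_left_cancel₀ (mul_ne_zero two_ne_zero hk2) hpq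
    have h2 := congrArg Complex.re h1
    have h3 := congrArg Complex.im h1
    simp only [Complex.add_re, Complex.add_im, Complex.mul_re, Complex.mul_im, Complex.I_re,
      Complex.I_im, Complex.intCast_re, Complex.intCast_im] at h2 h3
    norm_num at h2 h3
    exact Prod.ext h2 h3
  have hZ : ∀ p : ℤ × ℤ, ∀ x ∈ wordSpan e f v₀ p.1 p.2, T x = μ p • x := by
    intro p x hx
    change hT.sugawara x + ((k + 2) * Complex.I) • h 0 x = _
    rw [hT.sugawara_wordSpan hv₀ hx, hT.h_zero_wordSpan hv₀ hx]
    module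
  have hTN : ∀ x ∈ N, T x ∈ N := fun x hx =>
    add_mem (hT.sugawara_mem hN hx) (N.smul_mem _ (hN 0 x hx).2.2)
  suffices key : ∀ (D J : ℕ) (d j : ℤ), d = D → d - j = J → ∀ y ∈ N,
      y ∈ wordSpan e f v₀ d j → π y = 0 by
    intro x hx
    by_contra hπx
    obtain ⟨p, y, hyN, hyp, hy0⟩ := exists_mem_of_map_ne_zero hμ hZ htop hTN π hx hπx
    obtain ⟨h1, h2⟩ := zero_le_of_mem_wordSpan hyp fun h => hy0 (by rw [h, map_zero])
    exact hy0 (key p.1.toNat (p.1 - p.2).toNat p.1 p.2 (by omega) (by omega) y hyN hyp)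
  intro D
  induction D using Nat.strong_induction_on with
  | _ D ihD =>
  intro J
  induction J using Nat.strong_induction_on with
  | _ J ihJ =>
  intro d j hdD hjJ y hyN hy
  by_contra hy0
  have hyne : y ≠ 0 := fun h => hy0 (by rw [h, map_zero])
  have hjd := (zero_le_of_mem_wordSpan hy hyne).2
  have he0 : e' 0 (π y) = 0 := by
    rw [← (hπ 0 y).1]
    have hmem := hT.e_zero_mem_wordSpan hv₀ hy
    by_contra hc
    have := (zero_le_of_mem_wordSpan hmem fun h => hc (by rw [h, map_zero])).2
    exact hc (ihJ (J - 1) (by omega) d (j + 1) hdD (by omega) _ (hN 0 y hyN).1 hmem)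
  have hf1 : f' 1 (π y) = 0 := by
    rw [← (hπ 1 y).2.1]
    have hmem := hT.f_one_mem_wordSpan hv₀ hy
    by_contra hc
    have := (zero_le_of_mem_wordSpan hmem fun h => hc (by rw [h, map_zero])).1
    exact hc (ihD (D - 1) (by omega) J (d - 1) (j - 1) (by omega) (by omega) _
      (hN 1 y hyN).2.1 hmem)
  have hh0 : h' 0 (π y) = (2 * (j : ℂ)) • π y := by
    rw [← (hπ 0 y).2.2, hT.h_zero_wordSpan hv₀ hy, map_smul]
  have hcas : j * (j + 1) = ((K : ℤ) + 2) * d := by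
    have h1 := hT'.sugawara_singular he0 hf1
    rw [← hT.map_sugawara hT' hπ, hT.sugawara_wordSpan hv₀ hy, hh0, map_smul, map_smul, hh0,
      smul_smul, smul_smul, ← add_smul] at h1
    have h2 := smul_left_injective ℂ hy0 h1
    rw [hk] at h2
    have h3 : (j : ℂ) * (j + 1) = (K + 2) * d := by
      linear_combination (-1 / 2 : ℂ) * h2
    exact_mod_cast h3
  have hd0 : d ≠ 0 := by
    rintro rfl
    obtain ⟨c, rfl⟩ := Submodule.mem_span_singleton.1 (mem_span_vac_of_mem_wordSpan_zero hv₀ hy)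
    have hc : c ≠ 0 := fun h => hyne (by rw [h, zero_smul])
    exact hv₀N (by simpa [smul_smul, hc] using N.smul_mem c⁻¹ hyN)
  obtain ⟨A, hA⟩ := hnf d j y hy
  obtain ⟨B, hB⟩ := hne d j y hy
  obtain ⟨a, ha⟩ := exists_nat_weight_of_primitive (E := e' 0) (F := f' 0) (D := h' 0)
    (fun v => by rw [hT'.ef]; simp) (fun v => by rw [hT'.hf]; simp) hy0 he0 hh0 hA
  obtain ⟨b, hb⟩ := exists_nat_weight_of_primitive (E := f' 1) (F := e' (-1))
    (D := k • LinearMap.id - h' 0) (l := k - 2 * j)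
    (fun v => by
      rw [hT'.ef, neg_add_cancel, if_pos rfl]
      simp only [LinearMap.sub_apply, LinearMap.smul_apply, LinearMap.id_apply]
      push_cast
      module)
    (fun v => by
      simp only [LinearMap.sub_apply, LinearMap.smul_apply, LinearMap.id_apply, hT'.he, map_sub,
        map_smul, zero_add]
      module) hy0 hf1
    (by
      simp only [LinearMap.sub_apply, LinearMap.smul_apply, LinearMap.id_apply, hh0]
      module) hB
  have ha' : 2 * j = (a : ℤ) := by exact_mod_cast ha
  have hb' : (K : ℤ) - 2 * j = (b : ℤ) := by
    rw [hk] at hb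
    exact_mod_cast hb
  have hj0 : 0 ≤ j := by omega
  have hd1 : 1 ≤ d := by omega
  nlinarith [mul_nonneg hj0 (show (0 : ℤ) ≤ K - 2 * j by omega),
    mul_nonneg (show (0 : ℤ) ≤ K + 2 by omega) (sub_nonneg.2 hjd)]

end IsAffineTriple

/-! ### Representations of the affine Lie algebra of `sl₂` -/

namespace AffineSl2

attribute [local instance] LieRing.ofAssociativeRing

/-- The raising matrix unit of `sl₂`. -/
def slE : Sl2 := ⟨!![0, 1; 0, 0], by simp [LieAlgebra.SpecialLinear.sl, Matrix.trace_fin_two]⟩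

/-- The lowering matrix unit of `sl₂`. -/
def slF : Sl2 := ⟨!![0, 0; 1, 0], by simp [LieAlgebra.SpecialLinear.sl, Matrix.trace_fin_two]⟩

/-- The diagonal matrix `diag(1, -1)` of `sl₂`. -/
def slH : Sl2 := ⟨!![1, 0; 0, -1], by simp [LieAlgebra.SpecialLinear.sl, Matrix.trace_fin_two]⟩

theorem sl_one_one (x : Sl2) : x.1 1 1 = -x.1 0 0 := by
  have h : Matrix.trace x.1 = 0 := LinearMap.mem_ker.1 x.2
  rw [Matrix.trace_fin_two] at h
  linear_combination h

theorem sl_eq (x : Sl2) : x = x.1 0 1 • slE + x.1 1 0 • slF + x.1 0 0 • slH := by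
  refine Subtype.ext ?_
  ext i j
  fin_cases i <;> fin_cases j <;> simp [slE, slF, slH, sl_one_one]

theorem lie_val (x y : Sl2) : (⁅x, y⁆ : Sl2).1 = x.1 * y.1 - y.1 * x.1 :=
  LieAlgebra.SpecialLinear.sl_bracket _ _ x y

theorem lie_slE_slF : ⁅slE, slF⁆ = slH := by
  refine Subtype.ext ?_
  rw [lie_val]
  ext i j
  fin_cases i <;> fin_cases j <;> simp [slE, slF, slH]

theorem lie_slH_slE : ⁅slH, slE⁆ = (2 : ℂ) • slE := by
  refine Subtype.ext ?_
  rw [lie_val]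
  ext i j
  fin_cases i <;> fin_cases j <;> simp [slE, slH]
  norm_num

theorem lie_slH_slF : ⁅slH, slF⁆ = (-2 : ℂ) • slF := by
  refine Subtype.ext ?_
  rw [lie_val]
  ext i j
  fin_cases i <;> fin_cases j <;> simp [slF, slH]
  norm_num

theorem form_eq (x y : Sl2) :
    form x y = x.1 0 1 * y.1 1 0 + x.1 1 0 * y.1 0 1 + 2 * (x.1 0 0 * y.1 0 0) := by
  rw [form_apply, Matrix.trace_fin_two]
  simp only [Matrix.mul_apply, Fin.sum_univ_two, sl_one_one]
  ring

theorem current_add (x y : Sl2) (n : ℤ) : current (x + y) n = current x n + current y n := by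
  rw [current, current, current, ← LieAlgebra.of_add, TensorProduct.tmul_add]
  simp

theorem current_smul (c : ℂ) (x : Sl2) (n : ℤ) : current (c • x) n = c • current x n := by
  rw [current, current, ← LieAlgebra.of_smul, TensorProduct.tmul_smul]
  simp

theorem mem_span_current (X : Affine) :
    X ∈ Submodule.span ℂ (Set.range (fun p : Sl2 × ℤ => current p.1 p.2) ∪ {central}) := by
  obtain ⟨⟨l, t⟩⟩ := X
  set S := Submodule.span ℂ (Set.range (fun p : Sl2 × ℤ => current p.1 p.2) ∪ {central})
  have h1 : ∀ r : ℂ, LieAlgebra.ofProd cocycle (l, (TrivialLieModule.equiv ℂ _ ℂ).symm r) ∈ S := by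
    intro r
    rw [ofProd_eq_add]
    refine add_mem ?_ (Submodule.smul_mem _ _ (Submodule.subset_span (Or.inr rfl)))
    induction l using TensorProduct.induction_on with
    | zero => exact S.zero_mem
    | tmul P x =>
      induction P using AddMonoidAlgebra.induction_linear with
      | zero =>
        rw [TensorProduct.zero_tmul]
        exact S.zero_mem
      | add P Q hP hQ =>
        have := add_mem hP hQ
        rwa [← LieAlgebra.of_add, Prod.mk_add_mk, add_zero, ← TensorProduct.add_tmul] at this
      | single n c =>
        have : LieAlgebra.ofProd cocycle (AddMonoidAlgebra.single n c ⊗ₜ[ℂ] x, 0) =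
            c • current x n := by
          rw [current, ← LieAlgebra.of_smul, Prod.smul_mk, smul_zero, TensorProduct.smul_tmul',
            AddMonoidAlgebra.smul_single, smul_eq_mul, mul_one]
        rw [this]
        exact S.smul_mem _ (Submodule.subset_span (Or.inl ⟨(x, n), rfl⟩))
    | add l l' hl hl' =>
      have := add_mem hl hl'
      rwa [← LieAlgebra.of_add, Prod.mk_add_mk, add_zero] at this
  have h2 := h1 (TrivialLieModule.equiv ℂ _ ℂ t)
  rw [LinearEquiv.symm_apply_apply] at h2
  exact h2

section Rep

variable {M : Type*} [AddCommGroup M] [Module ℂ M]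

/-- The linear map from the affine Lie algebra determined by the images `ρ x n` of `x(n)` and the
level `k`. -/
def affineLinearMap (ρ : Sl2 →ₗ[ℂ] (ℤ → Module.End ℂ M)) (k : ℂ) :
    Affine →ₗ[ℂ] Module.End ℂ M where
  toFun X :=
    TensorProduct.lift ((AddMonoidAlgebra.basis ℤ ℂ).constr ℂ fun n => LinearMap.proj n ∘ₗ ρ)
      ((LieAlgebra.ofProd cocycle).symm X).1 +
    (TrivialLieModule.equiv ℂ _ ℂ ((LieAlgebra.ofProd cocycle).symm X).2 * k) • LinearMap.id
  map_add' X Y := by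
    rw [LieAlgebra.of_symm_add, Prod.fst_add, Prod.snd_add, map_add, map_add, add_mul, add_smul]
    abel
  map_smul' c X := by
    rw [LieAlgebra.of_symm_smul, Prod.smul_fst, Prod.smul_snd, map_smul, map_smul, smul_eq_mul,
      mul_assoc, mul_smul, RingHom.id_apply, smul_add]

theorem affineLinearMap_current (ρ : Sl2 →ₗ[ℂ] (ℤ → Module.End ℂ M)) (k : ℂ) (x : Sl2) (n : ℤ) :
    affineLinearMap ρ k (current x n) = ρ x n := by
  have h1 : AddMonoidAlgebra.single n (1 : ℂ) = AddMonoidAlgebra.basis ℤ ℂ n := by simp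
  simp only [affineLinearMap, current, LinearMap.coe_mk, AddHom.coe_mk, Equiv.symm_apply_apply,
    map_zero, zero_mul, zero_smul, add_zero, TensorProduct.lift.tmul]
  rw [h1, Module.Basis.constr_basis]
  rfl

theorem affineLinearMap_central (ρ : Sl2 →ₗ[ℂ] (ℤ → Module.End ℂ M)) (k : ℂ) :
    affineLinearMap ρ k central = k • LinearMap.id := by
  simp [affineLinearMap, central]

/-- The representation of the affine Lie algebra determined by operators `ρ x n` that satisfy the
commutation relations of level `k`. -/
def affineLieHom (ρ : Sl2 →ₗ[ℂ] (ℤ → Module.End ℂ M)) (k : ℂ)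
    (hρ : ∀ x y m n v, ρ x m (ρ y n v) - ρ y n (ρ x m v) =
      ρ ⁅x, y⁆ (m + n) v + (if m + n = 0 then (m : ℂ) * (k * form x y) else 0) • v) :
    Affine →ₗ⁅ℂ⁆ Module.End ℂ M where
  __ := affineLinearMap ρ k
  map_lie' {X Y} := by
    change affineLinearMap ρ k ⁅X, Y⁆ = ⁅affineLinearMap ρ k X, affineLinearMap ρ k Y⁆
    induction mem_span_current X using Submodule.span_induction with
    | zero => simp
    | add X X' _ _ hX hX' => rw [add_lie, map_add, map_add, add_lie, hX, hX']
    | smul c X _ hX => rw [smul_lie, map_smul, map_smul, smul_lie, hX]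
    | mem X hX =>
      induction mem_span_current Y using Submodule.span_induction with
      | zero => simp
      | add Y Y' _ _ hY hY' => rw [lie_add, map_add, map_add, lie_add, hY, hY']
      | smul c Y _ hY => rw [lie_smul, map_smul, map_smul, lie_smul, hY]
      | mem Y hY =>
        have hcentral : ∀ T : Module.End ℂ M, ⁅T, k • (LinearMap.id : Module.End ℂ M)⁆ = 0 := by
          intro T
          rw [lie_smul, Ring.lie_def]
          ext v
          simp
        rcases hY with ⟨⟨y, n⟩, rfl⟩ | hY
        · rcases hX with ⟨⟨x, m⟩, rfl⟩ | hX
          · simp only [lie_current, map_add, map_smul, affineLinearMap_current,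
              affineLinearMap_central]
            ext v
            rw [Ring.lie_def]
            change _ = ρ x m (ρ y n v) - ρ y n (ρ x m v)
            rw [hρ]
            simp only [LinearMap.add_apply, LinearMap.smul_apply, LinearMap.id_apply, smul_smul]
            congr 2
            split_ifs <;> ring
          · rw [Set.mem_singleton_iff.1 hX, ← lie_skew, lie_central, ← lie_skew,
              affineLinearMap_central, hcentral]
            simp
        · rw [Set.mem_singleton_iff.1 hY, lie_central, affineLinearMap_central, hcentral, map_zero]

theorem ι_lie (X Y : Affine) : (UniversalEnvelopingAlgebra.ι ℂ ⁅X, Y⁆ : Env) =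
    UniversalEnvelopingAlgebra.ι ℂ X * UniversalEnvelopingAlgebra.ι ℂ Y -
      UniversalEnvelopingAlgebra.ι ℂ Y * UniversalEnvelopingAlgebra.ι ℂ X := by
  rw [LieHom.map_lie, Ring.lie_def]

variable (R : Env →ₐ[ℂ] Module.End ℂ M)

/-- The operator by which `x(n)` acts in a representation of the enveloping algebra. -/
def opMode (x : Sl2) (n : ℤ) : Module.End ℂ M := R (UniversalEnvelopingAlgebra.ι ℂ (current x n))

theorem opMode_eq (x : Sl2) (n : ℤ) (v : M) : opMode R x n v = x.1 0 1 • opMode R slE n v +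
    x.1 1 0 • opMode R slF n v + x.1 0 0 • opMode R slH n v := by
  conv_lhs => rw [sl_eq x]
  simp only [opMode, current_add, current_smul, map_add, map_smul, LinearMap.add_apply,
    LinearMap.smul_apply]

theorem opMode_smul (c : ℂ) (x : Sl2) (n : ℤ) (v : M) :
    opMode R (c • x) n v = c • opMode R x n v := by
  simp only [opMode, current_smul, map_smul, LinearMap.smul_apply]

variable {R} in
theorem opMode_comm {k : ℂ} (hK : ∀ v, R (UniversalEnvelopingAlgebra.ι ℂ central) v = k • v)
    (x y : Sl2) (m n : ℤ) (v : M) : opMode R x m (opMode R y n v) =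
      opMode R y n (opMode R x m v) + opMode R ⁅x, y⁆ (m + n) v +
        (if m + n = 0 then (m : ℂ) * form x y * k else 0) • v := by
  have h1 := congrArg (fun u => R u v) (ι_lie (current x m) (current y n))
  simp only [lie_current, map_add, map_smul, map_sub, map_mul, LinearMap.add_apply,
    LinearMap.sub_apply, LinearMap.smul_apply, Module.End.mul_apply, hK, smul_smul] at h1
  rw [add_assoc, ← sub_eq_iff_eq_add']
  change _ = _ at h1
  simp only [opMode]
  rw [← h1]
  congr 2
  split_ifs <;> ring

variable {R} in
theorem isAffineTriple {k : ℂ} (hK : ∀ v, R (UniversalEnvelopingAlgebra.ι ℂ central) v = k • v)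
    (hs : ∀ v, ∃ N : ℕ, ∀ n : ℤ, N ≤ n → ∀ x, opMode R x n v = 0) :
    IsAffineTriple (opMode R slE) (opMode R slF) (opMode R slH) k where
  ef m n v := by
    have h1 : form slE slF = 1 := by rw [form_eq]; simp [slE, slF]
    rw [opMode_comm hK, lie_slE_slF, h1, mul_one]
  he m n v := by
    have h1 : form slH slE = 0 := by rw [form_eq]; simp [slE, slH]
    rw [opMode_comm hK, lie_slH_slE, h1, opMode_smul]
    simp
  hf m n v := by
    have h1 : form slH slF = 0 := by rw [form_eq]; simp [slF, slH]
    rw [opMode_comm hK, lie_slH_slF, h1, opMode_smul]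
    simp [sub_eq_add_neg]
  hh m n v := by
    have h1 : form slH slH = 2 := by rw [form_eq]; simp [slH]
    have h0 : opMode R 0 (m + n) v = 0 := by rw [opMode_eq]; simp
    rw [opMode_comm hK, lie_self, h0, h1, add_zero, mul_comm (m : ℂ)]
  ee m n v := by
    have h1 : form slE slE = 0 := by rw [form_eq]; simp [slE]
    have h0 : opMode R 0 (m + n) v = 0 := by rw [opMode_eq]; simp
    rw [opMode_comm hK, lie_self, h0, h1]
    simp
  ff m n v := by
    have h1 : form slF slF = 0 := by rw [form_eq]; simp [slF]
    have h0 : opMode R 0 (m + n) v = 0 := by rw [opMode_eq]; simp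
    rw [opMode_comm hK, lie_self, h0, h1]
    simp
  smooth v := by
    obtain ⟨N, hN⟩ := hs v
    exact ⟨N, fun n hn => ⟨hN n hn _, hN n hn _, hN n hn _⟩⟩

/-- A subspace that is stable under all `x(n)` and under `K` is stable under the enveloping
algebra. -/
theorem mem_of_opMode_mem {Z : Submodule ℂ M} (h : ∀ x n, ∀ v ∈ Z, opMode R x n v ∈ Z)
    (hK : ∀ v ∈ Z, R (UniversalEnvelopingAlgebra.ι ℂ central) v ∈ Z) (u : Env) :
    ∀ v ∈ Z, R u v ∈ Z := by
  let S : Subalgebra ℂ Env :=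
    { carrier := {u | ∀ v ∈ Z, R u v ∈ Z}
      mul_mem' := fun {a b} ha hb v hv => by
        rw [map_mul]
        exact ha _ (hb v hv)
      add_mem' := fun {a b} ha hb v hv => by
        rw [map_add]
        exact add_mem (ha v hv) (hb v hv)
      algebraMap_mem' := fun c v hv => by
        rw [AlgHom.commutes]
        exact Z.smul_mem c hv }
  have hι : ∀ X : Affine, UniversalEnvelopingAlgebra.ι ℂ X ∈ S := by
    intro X
    induction mem_span_current X using Submodule.span_induction with
    | zero =>
      rw [map_zero]
      exact S.zero_mem
    | add X Y _ _ hX hY =>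
      rw [map_add]
      exact S.add_mem hX hY
    | smul c X _ hX =>
      rw [map_smul]
      exact S.smul_mem hX c
    | mem X hX =>
      rcases hX with ⟨⟨x, n⟩, rfl⟩ | hX
      · exact h x n
      · rw [Set.mem_singleton_iff.1 hX]
        exact hK
  let l : Affine →ₗ⁅ℂ⁆ S :=
    { toFun := fun X => ⟨UniversalEnvelopingAlgebra.ι ℂ X, hι X⟩
      map_add' := fun X Y => Subtype.ext (map_add _ X Y)
      map_smul' := fun c X => Subtype.ext (map_smul _ c X)
      map_lie' := fun {X Y} => Subtype.ext (by rw [Ring.lie_def]; exact ι_lie X Y) }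
  have hid : S.val.comp (UniversalEnvelopingAlgebra.lift ℂ l) = AlgHom.id ℂ Env := by
    refine UniversalEnvelopingAlgebra.hom_ext _ (LieHom.ext fun X => ?_)
    change (UniversalEnvelopingAlgebra.lift ℂ l (UniversalEnvelopingAlgebra.ι ℂ X) : Env) = _
    rw [UniversalEnvelopingAlgebra.lift_ι_apply]
    rfl
  have hu : S.val (UniversalEnvelopingAlgebra.lift ℂ l u) = u := AlgHom.congr_fun hid u
  rw [← hu]
  exact (UniversalEnvelopingAlgebra.lift ℂ l u).2

end Rep

end AffineSl2

/-! ### The simple quotient of the vacuum module in an integrable representation -/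

namespace AffineSl2

theorem exists_liftQ {A W M : Type*} [Ring A] [Algebra ℂ A] [AddCommGroup W] [Module ℂ W]
    [Module A W] [IsScalarTower ℂ A W] [AddCommGroup M] [Module ℂ M] (S : Submodule A W)
    (L : W →ₗ[ℂ] M) (hL : ∀ x ∈ S, L x = 0) : ∃ L' : (W ⧸ S) →ₗ[ℂ] M, ∀ x, L' (S.mkQ x) = L x :=
  ⟨(Submodule.liftQ (S.restrictScalars ℂ) L hL) ∘ₗ
    (Submodule.Quotient.restrictScalarsEquiv ℂ S).symm.toLinearMap, fun _ => rfl⟩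

/-- The representation of the enveloping algebra on the vacuum module. -/
abbrev vacuumRep (k : ℂ) : Env →ₐ[ℂ] Module.End ℂ (VacuumModule k) := Algebra.lsmul ℂ ℂ _

theorem vacuumRep_mkQ (k : ℂ) (u w : Env) :
    vacuumRep k u ((vacuumIdeal k).mkQ w) = (vacuumIdeal k).mkQ (u * w) := rfl

theorem mkQ_eq_zero_of_opMode {k : ℂ} {x : Sl2} {n : ℤ} (hn : 0 ≤ n) :
    opMode (vacuumRep k) x n ((vacuumIdeal k).mkQ 1) = 0 := by
  rw [opMode, vacuumRep_mkQ, mul_one, Submodule.mkQ_apply, Submodule.Quotient.mk_eq_zero]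
  exact Submodule.subset_span (Or.inl ⟨x, n, hn, rfl⟩)

theorem ι_central_comm (u : Env) : (UniversalEnvelopingAlgebra.ι ℂ central : Env) * u =
    u * UniversalEnvelopingAlgebra.ι ℂ central := by
  -- The centraliser of `K` is a subspace stable under left multiplication by all `x(n)`.
  let Z : Submodule ℂ Env :=
    { carrier := {u | UniversalEnvelopingAlgebra.ι ℂ central * u =
        u * UniversalEnvelopingAlgebra.ι ℂ central}
      add_mem' := fun {a b} ha hb => by
        change _ * (a + b) = (a + b) * _
        rw [mul_add, add_mul, show _ * a = _ from ha, show _ * b = _ from hb]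
      zero_mem' := by simp
      smul_mem' := fun c a ha => by
        change _ * (c • a) = (c • a) * _
        rw [mul_smul_comm, smul_mul_assoc, show _ * a = _ from ha] }
  have h1 : ∀ X : Affine, (UniversalEnvelopingAlgebra.ι ℂ central : Env) *
      UniversalEnvelopingAlgebra.ι ℂ X =
      UniversalEnvelopingAlgebra.ι ℂ X * UniversalEnvelopingAlgebra.ι ℂ central := by
    intro X
    have := ι_lie X central
    rw [lie_central, map_zero, eq_comm, sub_eq_zero] at this
    exact this.symm
  have hstep : ∀ (X : Affine) (v : Env), v ∈ Z → UniversalEnvelopingAlgebra.ι ℂ X * v ∈ Z := by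
    intro X v hv
    change _ * (_ * v) = (_ * v) * _
    rw [← mul_assoc, h1, mul_assoc, show _ * v = _ from hv, mul_assoc]
  have := mem_of_opMode_mem (Algebra.lmul ℂ Env) (Z := Z) (fun x n v hv => hstep _ v hv)
    (fun v hv => hstep _ v hv) u 1 (by change _ * 1 = 1 * _; simp)
  change u * 1 ∈ Z at this
  rwa [mul_one] at this

theorem vacuumRep_central (k : ℂ) (w : VacuumModule k) :
    vacuumRep k (UniversalEnvelopingAlgebra.ι ℂ central) w = k • w := by
  obtain ⟨u, rfl⟩ := (vacuumIdeal k).mkQ_surjective w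
  have h1 : (vacuumIdeal k).mkQ (u * (UniversalEnvelopingAlgebra.ι ℂ central
      - algebraMap ℂ Env k)) = 0 := by
    rw [Submodule.mkQ_apply, Submodule.Quotient.mk_eq_zero]
    exact (vacuumIdeal k).smul_mem u (Submodule.subset_span (Or.inr rfl))
  rw [mul_sub, map_sub, sub_eq_zero] at h1
  rw [vacuumRep_mkQ, ι_central_comm, h1, ← Algebra.commutes, ← Algebra.smul_def]
  rfl

theorem vacuumRep_smooth (k : ℂ) (w : VacuumModule k) :
    ∃ N : ℕ, ∀ n : ℤ, N ≤ n → ∀ x, opMode (vacuumRep k) x n w = 0 := by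
  let Z : Submodule ℂ (VacuumModule k) :=
    { carrier := {w | ∃ N : ℕ, ∀ n : ℤ, N ≤ n → ∀ x, opMode (vacuumRep k) x n w = 0}
      add_mem' := fun {a b} ha hb => by
        obtain ⟨N, hN⟩ := ha
        obtain ⟨N', hN'⟩ := hb
        refine ⟨N + N', fun n hn x => ?_⟩
        rw [map_add, hN n (by push_cast at hn; omega), hN' n (by push_cast at hn; omega), add_zero]
      zero_mem' := ⟨0, fun n _ x => map_zero _⟩
      smul_mem' := fun c a ha => by
        obtain ⟨N, hN⟩ := ha
        exact ⟨N, fun n hn x => by rw [map_smul, hN n hn, smul_zero]⟩ }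
  have hZ : ∀ (y : Sl2) (m : ℤ), ∀ v ∈ Z, opMode (vacuumRep k) y m v ∈ Z := by
    rintro y m v ⟨N, hN⟩
    refine ⟨N + m.natAbs + 1, fun n hn x => ?_⟩
    rw [opMode_comm (vacuumRep_central k), hN n (by omega), hN (n + m) (by omega),
      if_neg (by omega)]
    simp
  obtain ⟨u, rfl⟩ := (vacuumIdeal k).mkQ_surjective w
  have := mem_of_opMode_mem (vacuumRep k) hZ
    (fun v hv => by rw [vacuumRep_central]; exact Z.smul_mem k hv) u ((vacuumIdeal k).mkQ 1)
    ⟨0, fun n hn x => mkQ_eq_zero_of_opMode (by exact_mod_cast hn)⟩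
  rw [vacuumRep_mkQ, mul_one] at this
  exact this

/-- The words in `f(0)` and `e(-1)` span the vacuum module. -/
theorem iSup_wordSpan_vacuumModule (k : ℂ) :
    ⨆ p : ℤ × ℤ, IsAffineTriple.wordSpan (opMode (vacuumRep k) slE) (opMode (vacuumRep k) slF)
      ((vacuumIdeal k).mkQ 1) p.1 p.2 = ⊤ := by
  have hT := isAffineTriple (vacuumRep_central k) (vacuumRep_smooth k)
  have hstable := hT.iSup_wordSpan_stable (v₀ := (vacuumIdeal k).mkQ 1) fun n hn =>
    ⟨mkQ_eq_zero_of_opMode hn, mkQ_eq_zero_of_opMode hn, mkQ_eq_zero_of_opMode hn⟩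
  set Z := ⨆ p : ℤ × ℤ, IsAffineTriple.wordSpan (opMode (vacuumRep k) slE)
    (opMode (vacuumRep k) slF) ((vacuumIdeal k).mkQ 1) p.1 p.2 with hZ
  have h1 : (vacuumIdeal k).mkQ 1 ∈ Z :=
    le_iSup (fun p : ℤ × ℤ => IsAffineTriple.wordSpan (opMode (vacuumRep k) slE)
      (opMode (vacuumRep k) slF) ((vacuumIdeal k).mkQ 1) p.1 p.2) (0, 0)
      (Submodule.subset_span IsAffineTriple.IsWord.vac)
  rw [eq_top_iff]
  rintro w -
  obtain ⟨u, rfl⟩ := (vacuumIdeal k).mkQ_surjective w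
  have := mem_of_opMode_mem (vacuumRep k) (Z := Z) (fun x n v hv => by
      rw [opMode_eq]
      exact add_mem (add_mem (Z.smul_mem _ (hstable n v hv).1) (Z.smul_mem _ (hstable n v hv).2.1))
        (Z.smul_mem _ (hstable n v hv).2.2))
    (fun v hv => by rw [vacuumRep_central]; exact Z.smul_mem k hv) u _ h1
  rwa [vacuumRep_mkQ, mul_one] at this

variable {M : Type*} [AddCommGroup M] [Module ℂ M] {R : Env →ₐ[ℂ] Module.End ℂ M}

/-- The universal property of the vacuum module. -/
theorem exists_vacuumModule_map {k : ℂ}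
    (hK : ∀ v, R (UniversalEnvelopingAlgebra.ι ℂ central) v = k • v) {v₁ : M}
    (hv₁ : ∀ x n, 0 ≤ n → opMode R x n v₁ = 0) :
    ∃ π : VacuumModule k →ₗ[ℂ] M, ∀ u, π ((vacuumIdeal k).mkQ u) = R u v₁ := by
  refine exists_liftQ (vacuumIdeal k) ((LinearMap.applyₗ v₁) ∘ₗ R.toLinearMap) fun u hu => ?_
  change R u v₁ = 0
  induction hu using Submodule.span_induction with
  | zero => simp
  | add u u' _ _ hu hu' => rw [map_add, LinearMap.add_apply, hu, hu', add_zero]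
  | smul a u _ hu => rw [smul_eq_mul, map_mul, Module.End.mul_apply, hu, map_zero]
  | mem u hu =>
    rcases hu with ⟨x, n, hn, rfl⟩ | hu
    · exact hv₁ x n hn
    · rw [Set.mem_singleton_iff.1 hu, map_sub, LinearMap.sub_apply, hK, AlgHom.commutes]
      simp [Module.algebraMap_end_apply]

theorem map_smul_of_map_mkQ {k : ℂ} {v₁ : M} {π : VacuumModule k →ₗ[ℂ] M}
    (hπ : ∀ u, π ((vacuumIdeal k).mkQ u) = R u v₁) (u : Env) (w : VacuumModule k) :
    π (u • w) = R u (π w) := by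
  obtain ⟨w, rfl⟩ := (vacuumIdeal k).mkQ_surjective w
  rw [← map_smul, hπ, hπ, smul_eq_mul, map_mul, Module.End.mul_apply]

/-- The kernel of the map from the vacuum module of level `K ∈ ℕ` to a smooth representation, given
by a vacuum vector on which `f(0)` and `e(-1)` act integrably, is the maximal submodule. -/
theorem mem_maximalSubmodule_iff {K : ℕ}
    (hK : ∀ v, R (UniversalEnvelopingAlgebra.ι ℂ central) v = (K : ℂ) • v)
    (hs : ∀ v, ∃ N : ℕ, ∀ n : ℤ, N ≤ n → ∀ x, opMode R x n v = 0) {v₁ : M} (hv₁0 : v₁ ≠ 0)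
    (hnf : ∀ d j, ∀ x ∈ IsAffineTriple.wordSpan (opMode R slE) (opMode R slF) v₁ d j,
      ∃ N : ℕ, (opMode R slF 0 ^ N) x = 0)
    (hne : ∀ d j, ∀ x ∈ IsAffineTriple.wordSpan (opMode R slE) (opMode R slF) v₁ d j,
      ∃ N : ℕ, (opMode R slE (-1) ^ N) x = 0)
    {π : VacuumModule (K : ℂ) →ₗ[ℂ] M}
    (hπ : ∀ u, π ((vacuumIdeal (K : ℂ)).mkQ u) = R u v₁) (w : VacuumModule (K : ℂ)) :
    w ∈ maximalSubmodule (K : ℂ) ↔ π w = 0 := by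
  have hT := isAffineTriple (vacuumRep_central K) (vacuumRep_smooth K)
  have hT' := isAffineTriple hK hs
  have hπmode : ∀ x n w, π (opMode (vacuumRep K) x n w) = opMode R x n (π w) :=
    fun x n w => map_smul_of_map_mkQ hπ _ w
  have hvac : π ((vacuumIdeal K).mkQ 1) = v₁ := by
    rw [hπ, map_one, Module.End.one_apply]
  have hword : ∀ d j x, x ∈ IsAffineTriple.wordSpan (opMode (vacuumRep K) slE)
      (opMode (vacuumRep K) slF) ((vacuumIdeal K).mkQ 1) d j →
      π x ∈ IsAffineTriple.wordSpan (opMode R slE) (opMode R slF) v₁ d j := by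
    intro d j x hx
    refine (Submodule.span_le.2 fun y hy => ?_ : _ ≤
      (IsAffineTriple.wordSpan (opMode R slE) (opMode R slF) v₁ d j).comap π) hx
    refine Submodule.subset_span ?_
    clear hx
    induction hy with
    | vac =>
      rw [hvac]
      exact IsAffineTriple.IsWord.vac
    | f_zero _ ih =>
      rw [hπmode]
      exact IsAffineTriple.IsWord.f_zero ih
    | e_neg_one _ ih =>
      rw [hπmode]
      exact IsAffineTriple.IsWord.e_neg_one ih
  let N₀ : Submodule Env (VacuumModule (K : ℂ)) :=
    { carrier := {w | π w = 0}
      add_mem' := fun {a b} ha hb => by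
        change π (a + b) = 0
        rw [map_add, show π a = 0 from ha, show π b = 0 from hb, add_zero]
      zero_mem' := map_zero π
      smul_mem' := fun u w hw => by
        change π (u • w) = 0
        rw [map_smul_of_map_mkQ hπ, show π w = 0 from hw, map_zero] }
  suffices hmax : maximalSubmodule (K : ℂ) = N₀ by
    rw [hmax]
    rfl
  refine le_antisymm (sSup_le fun N hN w hw => ?_) (le_sSup fun htop => hv₁0 ?_)
  · refine hT.map_eq_zero_of_stable hT' (fun n v => ⟨hπmode _ n v, hπmode _ n v, hπmode _ n v⟩)
      rfl (fun n hn => ⟨mkQ_eq_zero_of_opMode hn, mkQ_eq_zero_of_opMode hn,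
        mkQ_eq_zero_of_opMode hn⟩) (iSup_wordSpan_vacuumModule K)
      (fun d j x hx => hnf d j _ (hword d j x hx)) (fun d j x hx => hne d j _ (hword d j x hx))
      (N := N.restrictScalars ℂ)
      (fun n x hx => ⟨N.smul_mem _ hx, N.smul_mem _ hx, N.smul_mem _ hx⟩) (fun h1 => hN ?_) w hw
    rw [eq_top_iff]
    rintro w -
    obtain ⟨u, rfl⟩ := (vacuumIdeal (K : ℂ)).mkQ_surjective w
    have : (vacuumIdeal (K : ℂ)).mkQ u = u • (vacuumIdeal (K : ℂ)).mkQ 1 := by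
      rw [← map_smul, smul_eq_mul, mul_one]
    rw [this]
    exact N.smul_mem u h1
  · rw [← hvac]
    have : (vacuumIdeal (K : ℂ)).mkQ 1 ∈ N₀ := htop ▸ Submodule.mem_top
    exact this

theorem act_mkQ (k : ℂ) (x : Sl2) (n : ℤ) (w : VacuumModule k) :
    act k x n ((maximalSubmodule k).mkQ w) =
      (maximalSubmodule k).mkQ (opMode (vacuumRep k) x n w) := rfl

/-- In a smooth representation of level `K ∈ ℕ`, the submodule generated by a vacuum vector on
which `f(0)` and `e(-1)` act integrably is the simple quotient of the vacuum module. -/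
theorem exists_simpleQuotient_map {K : ℕ}
    (hK : ∀ v, R (UniversalEnvelopingAlgebra.ι ℂ central) v = (K : ℂ) • v)
    (hs : ∀ v, ∃ N : ℕ, ∀ n : ℤ, N ≤ n → ∀ x, opMode R x n v = 0) {v₁ : M} (hv₁0 : v₁ ≠ 0)
    (hv₁ : ∀ x n, 0 ≤ n → opMode R x n v₁ = 0)
    (hnf : ∀ d j, ∀ x ∈ IsAffineTriple.wordSpan (opMode R slE) (opMode R slF) v₁ d j,
      ∃ N : ℕ, (opMode R slF 0 ^ N) x = 0)
    (hne : ∀ d j, ∀ x ∈ IsAffineTriple.wordSpan (opMode R slE) (opMode R slF) v₁ d j,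
      ∃ N : ℕ, (opMode R slE (-1) ^ N) x = 0) :
    ∃ Ψ : SimpleQuotient (K : ℂ) →ₗ[ℂ] M, Function.Injective Ψ ∧ Ψ (vacuum K) = v₁ ∧
      (∀ x n u, Ψ (act K x n u) = opMode R x n (Ψ u)) ∧
      ∀ y, y ∈ LinearMap.range Ψ ↔ ∃ u, y = R u v₁ := by
  obtain ⟨π, hπ⟩ := exists_vacuumModule_map hK hv₁
  have hker := mem_maximalSubmodule_iff hK hs hv₁0 hnf hne hπ
  obtain ⟨Ψ, hΨ⟩ := exists_liftQ (maximalSubmodule (K : ℂ)) π fun x hx => (hker x).1 hx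
  have hΨ' : ∀ u : Env, Ψ ((maximalSubmodule (K : ℂ)).mkQ ((vacuumIdeal (K : ℂ)).mkQ u)) = R u v₁ :=
    fun u => (hΨ _).trans (hπ u)
  have hΨact : ∀ x n u, Ψ (act K x n u) = opMode R x n (Ψ u) := by
    intro x n u
    obtain ⟨w, rfl⟩ := (maximalSubmodule (K : ℂ)).mkQ_surjective u
    have h1 : π (opMode (vacuumRep K) x n w) = opMode R x n (π w) := map_smul_of_map_mkQ hπ _ w
    have h2 := congrArg Ψ (act_mkQ (K : ℂ) x n w)
    exact (h2.trans ((hΨ _).trans h1)).trans (congrArg (opMode R x n) (hΨ w).symm)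
  have hinj : Function.Injective Ψ := by
    rw [injective_iff_map_eq_zero]
    intro w hw
    obtain ⟨w, rfl⟩ := (maximalSubmodule (K : ℂ)).mkQ_surjective w
    rw [hΨ] at hw
    rw [Submodule.mkQ_apply, Submodule.Quotient.mk_eq_zero]
    exact (hker w).2 hw
  refine ⟨Ψ, hinj, ?_, hΨact, fun y => ⟨fun hy => ?_, fun hy => ?_⟩⟩
  · rw [vacuum, hΨ', map_one, Module.End.one_apply]
  · obtain ⟨w, hw⟩ := hy
    obtain ⟨w, rfl⟩ := (maximalSubmodule (K : ℂ)).mkQ_surjective w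
    obtain ⟨u, rfl⟩ := (vacuumIdeal (K : ℂ)).mkQ_surjective w
    exact ⟨u, hw.symm.trans (hΨ' u)⟩
  · obtain ⟨u, hu⟩ := hy
    exact ⟨_, (hΨ' u).trans hu.symm⟩

end AffineSl2

/-! ### Vertex subalgebras -/

namespace VertexAlgebra

variable {V : Type*} [AddCommGroup V] [Module ℂ V]

theorem finsum_mem_submodule (U : Submodule ℂ V) {f : ℕ → V} (hf : ∀ i, f i ∈ U) :
    ∑ᶠ i, f i ∈ U :=
  finsum_induction (· ∈ U) U.zero_mem (fun _ _ => U.add_mem) hf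

/-- The vertex algebra structure on `Q` induced by an injective linear map onto a vertex
subalgebra. -/
def pullback {Q : Type*} [AddCommGroup Q] [Module ℂ Q] (A : VertexAlgebra V) (Ψ : Q →ₗ[ℂ] V)
    (hΨ : Function.Injective Ψ) (hvac : A.vac ∈ LinearMap.range Ψ)
    (hmode : ∀ a b n, A.mode (Ψ a) n (Ψ b) ∈ LinearMap.range Ψ) : VertexAlgebra Q :=
  let F := LinearEquiv.ofInjective Ψ hΨ
  let μ : Q →ₗ[ℂ] (ℤ → Module.End ℂ Q) :=
    { toFun := fun a n => F.symm.toLinearMap ∘ₗ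
        (A.mode (Ψ a) n ∘ₗ Ψ).codRestrict (LinearMap.range Ψ) fun b => hmode a b n
      map_add' := fun a a' => by
        funext n
        ext b
        apply F.injective
        refine Subtype.ext ?_
        simp
      map_smul' := fun c a => by
        funext n
        ext b
        apply F.injective
        refine Subtype.ext ?_
        simp }
  have hμ : ∀ a n b, Ψ (μ a n b) = A.mode (Ψ a) n (Ψ b) := fun a n b =>
    congrArg Subtype.val (F.apply_symm_apply ⟨A.mode (Ψ a) n (Ψ b), hmode a b n⟩)
  have hv : Ψ (F.symm ⟨A.vac, hvac⟩) = A.vac :=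
    congrArg Subtype.val (F.apply_symm_apply ⟨A.vac, hvac⟩)
  { mode := μ
    vac := F.symm ⟨A.vac, hvac⟩
    vac_ne_zero := fun h => A.vac_ne_zero (by rw [← hv, h, map_zero])
    eventually_zero := fun a b => by
      obtain ⟨N, hN⟩ := A.eventually_zero (Ψ a) (Ψ b)
      exact ⟨N, fun n hn => hΨ (by rw [hμ, hN n hn, map_zero])⟩
    mode_vac_of_nonneg := fun a n hn =>
      hΨ (by rw [hμ, hv, A.mode_vac_of_nonneg _ n hn, map_zero])
    mode_vac_neg_one := fun a => hΨ (by rw [hμ, hv, A.mode_vac_neg_one])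
    borcherds := fun a b c p q r => by
      have hfin : ∀ g : ℕ → Q, Ψ (∑ᶠ i, g i) = ∑ᶠ i, Ψ (g i) := fun g =>
        Ψ.toAddMonoidHom.map_finsum_of_injective hΨ g
      refine hΨ ?_
      rw [hfin, hfin]
      simp only [map_smul, map_sub, hμ]
      exact A.borcherds _ _ _ p q r }

theorem map_pullback_mode {Q : Type*} [AddCommGroup Q] [Module ℂ Q] (A : VertexAlgebra V)
    (Ψ : Q →ₗ[ℂ] V) (hΨ : Function.Injective Ψ) (hvac : A.vac ∈ LinearMap.range Ψ)
    (hmode : ∀ a b n, A.mode (Ψ a) n (Ψ b) ∈ LinearMap.range Ψ) (a : Q) (n : ℤ) (b : Q) :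
    Ψ ((A.pullback Ψ hΨ hvac hmode).mode a n b) = A.mode (Ψ a) n (Ψ b) :=
  congrArg Subtype.val ((LinearEquiv.ofInjective Ψ hΨ).apply_symm_apply
    ⟨A.mode (Ψ a) n (Ψ b), hmode a b n⟩)

theorem map_pullback_vac {Q : Type*} [AddCommGroup Q] [Module ℂ Q] (A : VertexAlgebra V)
    (Ψ : Q →ₗ[ℂ] V) (hΨ : Function.Injective Ψ) (hvac : A.vac ∈ LinearMap.range Ψ)
    (hmode : ∀ a b n, A.mode (Ψ a) n (Ψ b) ∈ LinearMap.range Ψ) :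
    Ψ (A.pullback Ψ hΨ hvac hmode).vac = A.vac :=
  congrArg Subtype.val ((LinearEquiv.ofInjective Ψ hΨ).apply_symm_apply ⟨A.vac, hvac⟩)

theorem vac_mem_generated (A : VertexAlgebra V) (S : Set V) : A.vac ∈ A.generated S := by
  rw [generated, Submodule.mem_sInf]
  exact fun U hU => hU.1

theorem subset_generated (A : VertexAlgebra V) (S : Set V) {v : V} (hv : v ∈ S) :
    v ∈ A.generated S := by
  rw [generated, Submodule.mem_sInf]
  exact fun U hU => hU.2.1 hv

theorem mode_mem_generated (A : VertexAlgebra V) (S : Set V) {a b : V} (ha : a ∈ A.generated S)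
    (hb : b ∈ A.generated S) (n : ℤ) : A.mode a n b ∈ A.generated S := by
  rw [generated, Submodule.mem_sInf] at *
  exact fun U hU => hU.2.2 a (ha U hU) b (hb U hU) n

/-! ### The affine subalgebra attached to a root -/

variable {A : VertexAlgebra V} {ω : V} {H : A.HeisenbergSubspace}

/-- Root vectors `e ∈ V_1^α` and `f ∈ V_1^{-α}` with `(α,α) > 0`, normalised by `e(1)f = 𝟏`. -/
structure IsRootPair (A : VertexAlgebra V) (ω : V) (H : A.HeisenbergSubspace) (α : H.carrier)
    (e f : V) : Prop where
  pos : 0 < (H.form α α).re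
  im : (H.form α α).im = 0
  mem_e : e ∈ A.weightSpace ω H 1 α
  mem_f : f ∈ A.weightSpace ω H 1 (-α)
  one : A.mode e 1 f = A.vac

namespace AssumptionA

variable (hA : A.AssumptionA ω H)
include hA

theorem exists_isRootPair {α : H.carrier} (hpos : 0 < (H.form α α).re)
    (hne : A.weightSpace ω H 1 α ≠ ⊥) : ∃ e f, IsRootPair A ω H α e f := by
  have hn : (((1 : ℤ) : ℝ)) - 1 < (H.form α α).re / 2 := by
    push_cast
    linarith
  obtain ⟨e, he, he0⟩ := (Submodule.ne_bot_iff _).1 hne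
  obtain ⟨f, hf, c, hc, hcf⟩ := hA.exists_partner he he0 (hA.vir_one_eq_zero hn he)
  refine ⟨e, c⁻¹ • f, hpos, hA.A3 α ⟨1, hne⟩ α ⟨1, hne⟩, he, Submodule.smul_mem _ _ hf, ?_⟩
  rw [map_smul, show (1 : ℤ) = 2 * 1 - 1 by norm_num, hcf, smul_smul, inv_mul_cancel₀ hc, one_smul]

theorem eq_zero_of_real {α : H.carrier} {d : ℤ} {z : ℝ} {v : V}
    (hv : v ∈ A.weightSpace ω H d ((z : ℂ) • α)) (hd : (d : ℝ) < z ^ 2 * ((H.form α α).re / 2)) :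
    v = 0 := by
  refine hA.eq_zero_of_lt hv ?_
  have h1 : (H.form ((z : ℂ) • α) ((z : ℂ) • α)).re = z ^ 2 * (H.form α α).re := by
    simp only [map_smul, LinearMap.smul_apply, smul_eq_mul, Complex.re_ofReal_mul]
    ring
  rw [h1]
  linarith

end AssumptionA

namespace IsRootPair

variable {α : H.carrier} {e f : V} (hA : A.AssumptionA ω H) (hp : IsRootPair A ω H α e f)
include hp

theorem form_eq : H.form α α = ((H.form α α).re : ℂ) := Complex.ext rfl hp.im

theorem e_ne_zero : e ≠ 0 := by
  rintro rfl
  exact A.vac_ne_zero (by simpa using hp.one.symm)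

theorem f_ne_zero : f ≠ 0 := by
  rintro rfl
  exact A.vac_ne_zero (by simpa using hp.one.symm)

include hA

/-- Products of vectors in `V_1^{xα}` and `V_1^{yα}` whose charges add up to a non-zero one vanish
beyond the zeroth. -/
theorem mode_eq_zero {x y : ℝ} (hxy : x + y ≠ 0) {a b : V}
    (ha : a ∈ A.weightSpace ω H 1 ((x : ℂ) • α)) (hb : b ∈ A.weightSpace ω H 1 ((y : ℂ) • α))
    {n : ℤ} (hn : 1 ≤ n) : A.mode a n b = 0 := by
  have h := mode_mem_weightSpace hA.conformal ha hb n
  rw [← add_smul, ← Complex.ofReal_add] at h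
  refine hA.eq_zero_of_real h ?_
  have h2 : 0 < (x + y) ^ 2 * ((H.form α α).re / 2) := by
    have := hp.pos
    positivity
  exact (Int.cast_nonpos.2 (by omega)).trans_lt h2

/-- The products of order at least one of `e`, `f` and `α`, and the zeroth products. -/
theorem products : (∀ n : ℤ, 1 ≤ n → A.mode e n e = 0 ∧ A.mode f n f = 0 ∧ A.mode e n α = 0 ∧
      A.mode (α : V) n e = 0 ∧ A.mode f n α = 0 ∧ A.mode (α : V) n f = 0) ∧
    (∀ n : ℤ, 2 ≤ n → A.mode e n f = 0 ∧ A.mode f n e = 0 ∧ A.mode (α : V) n α = 0) ∧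
    A.mode f 1 e = A.vac ∧ A.mode (α : V) 1 α = H.form α α • A.vac ∧
    A.mode e 0 e = 0 ∧ A.mode f 0 f = 0 ∧ A.mode (α : V) 0 α = 0 ∧
    A.mode e 0 f = α ∧ A.mode f 0 e = -(α : V) ∧
    A.mode (α : V) 0 e = H.form α α • e ∧ A.mode e 0 α = -(H.form α α • e) ∧
    A.mode (α : V) 0 f = -(H.form α α • f) ∧ A.mode f 0 α = H.form α α • f := by
  have me : e ∈ A.weightSpace ω H 1 (((1 : ℝ) : ℂ) • α) := by simpa using hp.mem_e
  have mf : f ∈ A.weightSpace ω H 1 (((-1 : ℝ) : ℂ) • α) := by simpa using hp.mem_f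
  have ma : (α : V) ∈ A.weightSpace ω H 1 (((0 : ℝ) : ℂ) • α) := by
    simpa using hA.mem_weightSpace_one α
  have hee : ∀ n : ℤ, 1 ≤ n → A.mode e n e = 0 := fun n hn =>
    hp.mode_eq_zero hA (by norm_num) me me hn
  have hff : ∀ n : ℤ, 1 ≤ n → A.mode f n f = 0 := fun n hn =>
    hp.mode_eq_zero hA (by norm_num) mf mf hn
  have hea : ∀ n : ℤ, 1 ≤ n → A.mode e n α = 0 := fun n hn =>
    hp.mode_eq_zero hA (by norm_num) me ma hn
  have hae : ∀ n : ℤ, 1 ≤ n → A.mode (α : V) n e = 0 := fun n hn =>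
    hp.mode_eq_zero hA (by norm_num) ma me hn
  have hfa : ∀ n : ℤ, 1 ≤ n → A.mode f n α = 0 := fun n hn =>
    hp.mode_eq_zero hA (by norm_num) mf ma hn
  have haf : ∀ n : ℤ, 1 ≤ n → A.mode (α : V) n f = 0 := fun n hn =>
    hp.mode_eq_zero hA (by norm_num) ma mf hn
  have hef : ∀ n : ℤ, 2 ≤ n → A.mode e n f = 0 := fun n hn =>
    hA.mode_pair_eq_zero hp.mem_e hp.mem_f (by omega)
  have hfe : ∀ n : ℤ, 2 ≤ n → A.mode f n e = 0 := fun n hn =>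
    hA.mode_pair_eq_zero (β := -α) hp.mem_f (by simpa using hp.mem_e) (by omega)
  have hn : (((1 : ℤ) : ℝ)) - 1 < (H.form α α).re / 2 := by
    have := hp.pos
    push_cast
    linarith
  have hef0 : A.mode e 0 f = α := by
    have := hA.mode_pair_subtop hn hp.mem_e hp.mem_f (c := 1) (by rw [one_smul]; exact hp.one)
    simpa using this
  have hef1 : A.mode e 1 f = (1 : ℂ) • A.vac := by rw [one_smul, hp.one]
  have hself : ∀ x : V, x = -x → x = 0 := fun x hx => by
    have h2 : (2 : ℂ) • x = 0 := by
      nth_rewrite 1 [two_smul, hx]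
      exact neg_add_cancel x
    exact (smul_eq_zero.1 h2).resolve_left two_ne_zero
  have hae0 : A.mode (α : V) 0 e = H.form α α • e := (mem_weightSpace_iff.1 hp.mem_e).2 α
  have haf0 : A.mode (α : V) 0 f = -(H.form α α • f) := by
    simpa using (mem_weightSpace_iff.1 hp.mem_f).2 α
  refine ⟨fun n hn => ⟨hee n hn, hff n hn, hea n hn, hae n hn, hfa n hn, haf n hn⟩,
    fun n hn => ⟨hef n hn, hfe n hn, H.mode_of_two_le α α n hn⟩, ?_, H.mode_one α α, ?_, ?_, ?_,
    hef0, ?_, hae0, ?_, haf0, ?_⟩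
  · rw [A.mode_one_skew hef1 hef, one_smul]
  · exact hself _ (A.mode_zero_skew (κ := 0) (by rw [hee 1 le_rfl, zero_smul])
      fun n hn => hee n (by omega))
  · exact hself _ (A.mode_zero_skew (κ := 0) (by rw [hff 1 le_rfl, zero_smul])
      fun n hn => hff n (by omega))
  · simpa using (mem_weightSpace_iff.1 (hA.mem_weightSpace_one α)).2 α
  · rw [A.mode_zero_skew hef1 hef, hef0]
  · rw [A.mode_zero_skew (κ := 0) (by rw [hae 1 le_rfl, zero_smul]) fun n hn => hae n (by omega),
      hae0]
  · rw [A.mode_zero_skew (κ := 0) (by rw [haf 1 le_rfl, zero_smul]) fun n hn => haf n (by omega),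
      haf0, neg_neg]

end IsRootPair

end VertexAlgebra

/-! ### The action of affine `sl₂` on a vertex algebra with a root -/

namespace VertexAlgebra

open AffineSl2

variable {V : Type*} [AddCommGroup V] [Module ℂ V] {A : VertexAlgebra V} {ω : V}
  {H : A.HeisenbergSubspace}

/-- The level `2/(α,α)` of the affine Lie algebra attached to a root `α`. -/
def rootLevel (H : A.HeisenbergSubspace) (α : H.carrier) : ℂ := 2 / H.form α α

/-- The embedding of `sl₂` into `V_1` that sends the standard generators to `e`, `kf` and `kα`,
where `k = 2/(α,α)`. -/
def slMap (α : H.carrier) (e f : V) : Sl2 →ₗ[ℂ] V where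
  toFun x := x.1 0 1 • e + (x.1 1 0 * rootLevel H α) • f + (x.1 0 0 * rootLevel H α) • (α : V)
  map_add' x y := by
    have h : ∀ i j, (x + y).1 i j = x.1 i j + y.1 i j := fun _ _ => rfl
    simp only [h]
    module
  map_smul' c x := by
    have h : ∀ i j, (c • x).1 i j = c * x.1 i j := fun _ _ => rfl
    simp only [h, RingHom.id_apply]
    module

theorem slMap_slE (α : H.carrier) (e f : V) : slMap α e f slE = e := by
  simp [slMap, slE]

theorem slMap_slF (α : H.carrier) (e f : V) : slMap α e f slF = rootLevel H α • f := by
  simp [slMap, slF]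

theorem slMap_slH (α : H.carrier) (e f : V) : slMap α e f slH = rootLevel H α • (α : V) := by
  simp [slMap, slH]

theorem mode_slMap (α : H.carrier) (e f : V) (x y : Sl2) (n : ℤ) :
    A.mode (slMap α e f x) n (slMap α e f y) =
    (x.1 0 1 * y.1 0 1) • A.mode e n e + (x.1 0 1 * (y.1 1 0 * rootLevel H α)) • A.mode e n f
    + (x.1 0 1 * (y.1 0 0 * rootLevel H α)) • A.mode e n α
    + (x.1 1 0 * rootLevel H α * y.1 0 1) • A.mode f n e
    + (x.1 1 0 * rootLevel H α * (y.1 1 0 * rootLevel H α)) • A.mode f n f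
    + (x.1 1 0 * rootLevel H α * (y.1 0 0 * rootLevel H α)) • A.mode f n α
    + (x.1 0 0 * rootLevel H α * y.1 0 1) • A.mode (α : V) n e
    + (x.1 0 0 * rootLevel H α * (y.1 1 0 * rootLevel H α)) • A.mode (α : V) n f
    + (x.1 0 0 * rootLevel H α * (y.1 0 0 * rootLevel H α)) • A.mode (α : V) n α := by
  simp only [slMap, LinearMap.coe_mk, AddHom.coe_mk, map_add, map_smul, Pi.add_apply,
    Pi.smul_apply, LinearMap.add_apply, LinearMap.smul_apply]
  module

theorem exists_nat_lt_sq_mul {s : ℝ} (hs : 0 < s) (d m z : ℝ) :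
    ∃ N : ℕ, d - m * N < (z + N) ^ 2 * s := by
  obtain ⟨N, hN⟩ := exists_nat_ge (1 + (|d + m * z| + |m| + 1) / s - z)
  have h0 : 0 ≤ (|d + m * z| + |m| + 1) / s := by positivity
  have h1 : 1 ≤ z + N := by linarith
  have h2 : (|d + m * z| + |m| + 1) ≤ (z + N) * s := by
    rw [← div_le_iff₀ hs]
    linarith
  refine ⟨N, ?_⟩
  have h3 : d + m * z ≤ |d + m * z| := le_abs_self _
  have h4 : -m ≤ |m| := neg_le_abs _
  have h5 := mul_le_mul_of_nonneg_left h2 (zero_le_one.trans h1)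
  have h6 := mul_le_mul_of_nonneg_left h4 (zero_le_one.trans h1)
  have h7 := mul_le_mul_of_nonneg_right h1 (abs_nonneg (d + m * z))
  nlinarith

namespace IsRootPair

variable {α : H.carrier} {e f : V} (hA : A.AssumptionA ω H) (hp : IsRootPair A ω H α e f)
include hp

theorem rootLevel_mul : rootLevel H α * H.form α α = 2 := by
  rw [rootLevel, div_mul_cancel₀]
  intro h
  have := hp.pos
  rw [h] at this
  exact lt_irrefl _ this

theorem rootLevel_ne_zero : rootLevel H α ≠ 0 := by
  intro h
  have := hp.rootLevel_mul
  rw [h, zero_mul] at this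
  exact two_ne_zero this.symm

include hA

theorem slMap_mode_zero (x y : Sl2) :
    A.mode (slMap α e f x) 0 (slMap α e f y) = slMap α e f ⁅x, y⁆ := by
  obtain ⟨-, -, -, -, h1, h2, h3, h4, h5, h6, h7, h8, h9⟩ := hp.products hA
  rw [mode_slMap, h1, h2, h3, h4, h5, h6, h7, h8, h9]
  have hk := hp.rootLevel_mul
  have e01 : (⁅x, y⁆ : Sl2).1 0 1 = 2 * (x.1 0 0 * y.1 0 1 - x.1 0 1 * y.1 0 0) := by
    rw [lie_val, Matrix.sub_apply, Matrix.mul_apply, Matrix.mul_apply, Fin.sum_univ_two,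
      Fin.sum_univ_two, sl_one_one, sl_one_one]
    ring
  have e10 : (⁅x, y⁆ : Sl2).1 1 0 = 2 * (x.1 1 0 * y.1 0 0 - x.1 0 0 * y.1 1 0) := by
    rw [lie_val, Matrix.sub_apply, Matrix.mul_apply, Matrix.mul_apply, Fin.sum_univ_two,
      Fin.sum_univ_two, sl_one_one, sl_one_one]
    ring
  have e00 : (⁅x, y⁆ : Sl2).1 0 0 = x.1 0 1 * y.1 1 0 - x.1 1 0 * y.1 0 1 := by
    rw [lie_val, Matrix.sub_apply, Matrix.mul_apply, Matrix.mul_apply, Fin.sum_univ_two,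
      Fin.sum_univ_two]
    ring
  simp only [slMap, LinearMap.coe_mk, AddHom.coe_mk, e01, e10, e00, smul_zero, smul_neg, smul_smul]
  simp only [← hk]
  module

theorem slMap_mode_one (x y : Sl2) :
    A.mode (slMap α e f x) 1 (slMap α e f y) = (rootLevel H α * form x y) • A.vac := by
  obtain ⟨h0, -, h1, h2, -⟩ := hp.products hA
  obtain ⟨h3, h4, h5, h6, h7, h8⟩ := h0 1 le_rfl
  rw [mode_slMap, h1, h2, h3, h4, h5, h6, h7, h8, hp.one, AffineSl2.form_eq, ← hp.rootLevel_mul]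
  module

theorem slMap_mode_of_two_le (x y : Sl2) (n : ℤ) (hn : 2 ≤ n) :
    A.mode (slMap α e f x) n (slMap α e f y) = 0 := by
  obtain ⟨h0, h0', -⟩ := hp.products hA
  obtain ⟨h3, h4, h5, h6, h7, h8⟩ := h0 n (by omega)
  obtain ⟨h1, h2, h9⟩ := h0' n hn
  rw [mode_slMap, h1, h2, h3, h4, h5, h6, h7, h8, h9]
  simp

/-- The action of the enveloping algebra of the affine Lie algebra on `V`, at level `2/(α,α)`. -/
def rep : Env →ₐ[ℂ] Module.End ℂ V :=
  UniversalEnvelopingAlgebra.lift ℂ (affineLieHom (A.mode ∘ₗ slMap α e f) (rootLevel H α)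
    fun x y m n v => by
      have := A.commutator_of_mode_one (hp.slMap_mode_one hA x y) (hp.slMap_mode_of_two_le hA x y)
        m n v
      rw [hp.slMap_mode_zero hA] at this
      exact this)

theorem opMode_rep (x : Sl2) (n : ℤ) : opMode (hp.rep hA) x n = A.mode (slMap α e f x) n := by
  rw [opMode, rep, UniversalEnvelopingAlgebra.lift_ι_apply]
  exact affineLinearMap_current _ _ x n

theorem rep_central (v : V) :
    hp.rep hA (UniversalEnvelopingAlgebra.ι ℂ central) v = rootLevel H α • v := by
  rw [rep, UniversalEnvelopingAlgebra.lift_ι_apply]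
  exact LinearMap.congr_fun (affineLinearMap_central (A.mode ∘ₗ slMap α e f) (rootLevel H α)) v

theorem rep_smooth (v : V) :
    ∃ N : ℕ, ∀ n : ℤ, N ≤ n → ∀ x, opMode (hp.rep hA) x n v = 0 := by
  obtain ⟨a, ha⟩ := A.eventually_zero e v
  obtain ⟨b, hb⟩ := A.eventually_zero f v
  obtain ⟨c, hc⟩ := A.eventually_zero α v
  refine ⟨a.toNat + b.toNat + c.toNat, fun n hn x => ?_⟩
  rw [hp.opMode_rep]
  simp only [slMap, LinearMap.coe_mk, AddHom.coe_mk, map_add, map_smul, Pi.add_apply,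
    Pi.smul_apply, LinearMap.add_apply, LinearMap.smul_apply, ha n (by omega), hb n (by omega),
    hc n (by omega), smul_zero, add_zero]

theorem opMode_vac (x : Sl2) (n : ℤ) (hn : 0 ≤ n) : opMode (hp.rep hA) x n A.vac = 0 := by
  rw [hp.opMode_rep, A.mode_vac_of_nonneg _ n hn]

theorem isAffineTriple_rep : IsAffineTriple (opMode (hp.rep hA) slE) (opMode (hp.rep hA) slF)
    (opMode (hp.rep hA) slH) (rootLevel H α) :=
  isAffineTriple (hp.rep_central hA) (hp.rep_smooth hA)

theorem opMode_slH_zero {d : ℤ} {z : ℂ} {v : V} (hv : v ∈ A.weightSpace ω H d (z • α)) :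
    opMode (hp.rep hA) slH 0 v = (2 * z) • v := by
  rw [hp.opMode_rep, slMap_slH, map_smul, Pi.smul_apply, LinearMap.smul_apply,
    (mem_weightSpace_iff.1 hv).2, map_smul, smul_smul, smul_eq_mul, ← hp.rootLevel_mul]
  ring_nf

theorem opMode_slE_mem (m : ℤ) {d : ℤ} {z : ℂ} {v : V} (hv : v ∈ A.weightSpace ω H d (z • α)) :
    opMode (hp.rep hA) slE m v ∈ A.weightSpace ω H (d - m) ((z + 1) • α) := by
  rw [hp.opMode_rep, slMap_slE]
  convert mode_mem_weightSpace hA.conformal hp.mem_e hv m using 2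
  · ring
  · module

theorem opMode_slF_mem (m : ℤ) {d : ℤ} {z : ℂ} {v : V} (hv : v ∈ A.weightSpace ω H d (z • α)) :
    opMode (hp.rep hA) slF m v ∈ A.weightSpace ω H (d - m) ((z - 1) • α) := by
  rw [hp.opMode_rep, slMap_slF, map_smul, Pi.smul_apply, LinearMap.smul_apply]
  refine Submodule.smul_mem _ _ ?_
  convert mode_mem_weightSpace hA.conformal hp.mem_f hv m using 2
  · ring
  · module

theorem opMode_slE_pow_mem (m : ℤ) {d : ℤ} {z : ℂ} {v : V}
    (hv : v ∈ A.weightSpace ω H d (z • α)) (N : ℕ) :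
    (opMode (hp.rep hA) slE m ^ N) v ∈ A.weightSpace ω H (d - m * N) ((z + N) • α) := by
  induction N with
  | zero => simpa using hv
  | succ N ih =>
    rw [pow_succ', Module.End.mul_apply]
    convert hp.opMode_slE_mem hA m ih using 2
    · push_cast
      ring
    · push_cast
      module

theorem opMode_slF_pow_mem (m : ℤ) {d : ℤ} {z : ℂ} {v : V}
    (hv : v ∈ A.weightSpace ω H d (z • α)) (N : ℕ) :
    (opMode (hp.rep hA) slF m ^ N) v ∈ A.weightSpace ω H (d - m * N) ((z - N) • α) := by
  induction N with
  | zero => simpa using hv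
  | succ N ih =>
    rw [pow_succ', Module.End.mul_apply]
    convert hp.opMode_slF_mem hA m ih using 2
    · push_cast
      ring
    · push_cast
      module

/-- Along a chain of fixed slope the bound `d ≥ (β,β)/2` fails, since its right-hand side grows
quadratically. -/
theorem exists_opMode_slE_pow_eq_zero (m : ℤ) {d : ℤ} {z : ℝ} {v : V}
    (hv : v ∈ A.weightSpace ω H d ((z : ℂ) • α)) :
    ∃ N : ℕ, (opMode (hp.rep hA) slE m ^ N) v = 0 := by
  obtain ⟨N, hN⟩ := exists_nat_lt_sq_mul (half_pos hp.pos) d m z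
  have h := hp.opMode_slE_pow_mem hA m hv N
  rw [show (z : ℂ) + N = ((z + N : ℝ) : ℂ) by push_cast; rfl] at h
  exact ⟨N, hA.eq_zero_of_real h (by push_cast; exact hN)⟩

theorem exists_opMode_slF_pow_eq_zero (m : ℤ) {d : ℤ} {z : ℝ} {v : V}
    (hv : v ∈ A.weightSpace ω H d ((z : ℂ) • α)) :
    ∃ N : ℕ, (opMode (hp.rep hA) slF m ^ N) v = 0 := by
  obtain ⟨N, hN⟩ := exists_nat_lt_sq_mul (half_pos hp.pos) d m (-z)
  have h := hp.opMode_slF_pow_mem hA m hv N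
  rw [show (z : ℂ) - N = ((z - N : ℝ) : ℂ) by push_cast; rfl] at h
  refine ⟨N, hA.eq_zero_of_real h (by push_cast; convert hN using 2; ring)⟩

end IsRootPair

end VertexAlgebra

/-! ### Integrality of the level and multiples of roots -/

namespace VertexAlgebra

open AffineSl2 IsAffineTriple

variable {V : Type*} [AddCommGroup V] [Module ℂ V] {A : VertexAlgebra V} {ω : V}
  {H : A.HeisenbergSubspace}

namespace IsRootPair

variable {α : H.carrier} {e f : V} (hA : A.AssumptionA ω H) (hp : IsRootPair A ω H α e f)
include hp

theorem wordSpan_le_weightSpace (d j : ℤ) :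
    wordSpan (opMode (hp.rep hA) slE) (opMode (hp.rep hA) slF) A.vac d j ≤
      A.weightSpace ω H d (((j : ℝ) : ℂ) • α) := by
  refine Submodule.span_le.2 fun w hw => ?_
  induction hw with
  | vac => simpa using vac_mem_weightSpace
  | f_zero hw ih =>
    rw [SetLike.mem_coe]
    convert hp.opMode_slF_mem hA 0 ih using 2
    · ring
    · push_cast
      module
  | e_neg_one hw ih =>
    rw [SetLike.mem_coe]
    convert hp.opMode_slE_mem hA (-1) ih using 2
    · ring
    · push_cast
      module

include hA

/-- The vacuum is a primitive vector of weight `2/(α,α)` for the `sl₂` spanned by `f(1)`, `e(-1)`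
and `k - h(0)`, which acts locally nilpotently. -/
theorem exists_nat_rootLevel : ∃ K : ℕ, 0 < K ∧ rootLevel H α = K := by
  have hT := hp.isAffineTriple_rep hA
  have hv : A.vac ∈ A.weightSpace ω H 0 (((0 : ℝ) : ℂ) • α) := by
    simpa using vac_mem_weightSpace
  obtain ⟨N, hN⟩ := hp.exists_opMode_slE_pow_eq_zero hA (-1) hv
  obtain ⟨K, hK⟩ := exists_nat_weight_of_primitive (E := opMode (hp.rep hA) slF 1)
    (F := opMode (hp.rep hA) slE (-1))
    (D := rootLevel H α • LinearMap.id - opMode (hp.rep hA) slH 0) (l := rootLevel H α)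
    (fun v => by
      rw [hT.ef, neg_add_cancel, if_pos rfl]
      simp only [LinearMap.sub_apply, LinearMap.smul_apply, LinearMap.id_apply]
      push_cast
      module)
    (fun v => by
      simp only [LinearMap.sub_apply, LinearMap.smul_apply, LinearMap.id_apply, hT.he, map_sub,
        map_smul, zero_add]
      module) A.vac_ne_zero (hp.opMode_vac hA slF 1 zero_le_one)
    (by
      simp only [LinearMap.sub_apply, LinearMap.smul_apply, LinearMap.id_apply,
        hp.opMode_vac hA slH 0 le_rfl, sub_zero]) hN
  refine ⟨K, Nat.pos_of_ne_zero ?_, hK⟩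
  rintro rfl
  exact hp.rootLevel_ne_zero (by simpa using hK)

/-- A multiple `mα` of a root with `V_1^{mα} ≠ 0` has `2m ∈ ℤ`: this is its weight with respect to
the `sl₂` of zero modes, which acts locally nilpotently. -/
theorem exists_int_of_weightSpace_ne_bot {m : ℂ} (hm : A.weightSpace ω H 1 (m • α) ≠ ⊥) :
    ∃ d : ℤ, 2 * m = d := by
  have hα : A.weightSpace ω H 1 α ≠ ⊥ :=
    (Submodule.ne_bot_iff _).2 ⟨e, hp.mem_e, hp.e_ne_zero⟩
  obtain ⟨z, rfl⟩ : ∃ z : ℝ, m = z := by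
    have h := hA.A3 α ⟨1, hα⟩ (m • α) ⟨1, hm⟩
    rw [map_smul, smul_eq_mul, hp.form_eq, Complex.im_mul_ofReal] at h
    exact ⟨m.re, Complex.ext rfl ((mul_eq_zero.1 h).resolve_right hp.pos.ne')⟩
  obtain ⟨u, hu, hu0⟩ := (Submodule.ne_bot_iff _).1 hm
  have hT := hp.isAffineTriple_rep hA
  obtain ⟨N, hN⟩ := hp.exists_opMode_slE_pow_eq_zero hA 0 hu
  refine exists_int_weight_of_nilpotent (E := opMode (hp.rep hA) slE 0)
    (F := opMode (hp.rep hA) slF 0) (D := opMode (hp.rep hA) slH 0)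
    (fun v => by rw [hT.ef]; simp) (fun v => by rw [hT.he]; simp) (fun v => by rw [hT.hf]; simp)
    hu0 (hp.opMode_slH_zero hA hu) hN fun i => ?_
  have h := hp.opMode_slE_pow_mem hA 0 hu i
  rw [show (z : ℂ) + i = ((z + i : ℝ) : ℂ) by push_cast; rfl] at h
  exact hp.exists_opMode_slF_pow_eq_zero hA 0 h

end IsRootPair

namespace AssumptionA

variable (hA : A.AssumptionA ω H) {α : H.carrier}
include hA

theorem finrank_eq_one (hpos : 0 < (H.form α α).re) (hne : A.weightSpace ω H 1 α ≠ ⊥) :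
    Module.finrank ℂ (A.weightSpace ω H 1 α) = 1 := by
  have := hA.A6 1 α
  refine le_antisymm (hA.finrank_weightSpace_le_one (by push_cast; linarith)) ?_
  exact Submodule.one_le_finrank_iff.2 hne

/-- In `V_1`, twice a root is not a root. -/
theorem weightSpace_two_smul_eq_bot (hpos : 0 < (H.form α α).re)
    (hne : A.weightSpace ω H 1 α ≠ ⊥) : A.weightSpace ω H 1 ((2 : ℂ) • α) = ⊥ := by
  obtain ⟨e, f, hp⟩ := hA.exists_isRootPair hpos hne
  have hn : (((1 : ℤ) : ℝ)) - 1 < (H.form α α).re / 2 := by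
    push_cast
    linarith
  rw [Submodule.eq_bot_iff]
  intro u hu
  obtain ⟨-, -, -, -, hee, -⟩ := hp.products hA
  have hfu : A.mode f 0 u ∈ A.weightSpace ω H 1 α := by
    convert mode_mem_weightSpace hA.conformal hp.mem_f hu 0 using 2
    · norm_num
    · module
  obtain ⟨c, hc⟩ := (finrank_eq_one_iff_of_nonzero' (⟨e, hp.mem_e⟩ : A.weightSpace ω H 1 α)
    (fun h => hp.e_ne_zero (congrArg Subtype.val h))).1 (hA.finrank_eq_one hpos hne) ⟨_, hfu⟩
  have hc' : A.mode f 0 u = c • e := (congrArg Subtype.val hc).symm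
  refine hA.chain_start_eq_zero (j₀ := 2) (β := α) hn hp.mem_e hp.mem_f (c := 1) one_ne_zero
    (by rw [one_smul]; exact hp.one) (by norm_num) (by simpa using hu) fun i => ?_
  -- `f(0)u` lies in `V_1^α = ℂe`, which `e(0)` annihilates.
  rcases Nat.eq_zero_or_pos i with rfl | hi
  · simp only [mul_one, sub_self, mul_zero, Nat.cast_zero, add_zero, hc', map_smul]
    simp [hee]
  · have h2 : A.mode f ((2 : ℤ) * (2 * 1 - 2) + i) u = 0 := by
      have mf : f ∈ A.weightSpace ω H 1 (((-1 : ℝ) : ℂ) • α) := by simpa using hp.mem_f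
      have mu : u ∈ A.weightSpace ω H 1 (((2 : ℝ) : ℂ) • α) := by simpa using hu
      exact hp.mode_eq_zero hA (by norm_num) mf mu (by omega)
    exact (congrArg _ h2).trans (map_zero _)

/-- If `α` and `mα` are both roots, each is a half-integral multiple of the other; the ratios `±2`
and `±1/2` are excluded since twice a root is not a root. -/
theorem weightSpace_smul_eq_bot (hpos : 0 < (H.form α α).re)
    (hne : A.weightSpace ω H 1 α ≠ ⊥) {m : ℂ} (hm1 : m ≠ -1) (hm0 : m ≠ 0) (hm2 : m ≠ 1) :
    A.weightSpace ω H 1 (m • α) = ⊥ := by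
  by_contra hm
  obtain ⟨e, f, hp⟩ := hA.exists_isRootPair hpos hne
  have hneg : A.weightSpace ω H 1 (-α) ≠ ⊥ :=
    (Submodule.ne_bot_iff _).2 ⟨f, hp.mem_f, hp.f_ne_zero⟩
  obtain ⟨a, ha⟩ := hp.exists_int_of_weightSpace_ne_bot hA hm
  have hform : (H.form (m • α) (m • α)).re = ((a : ℝ) / 2) ^ 2 * (H.form α α).re := by
    rw [show m = (((a : ℝ) / 2 : ℝ) : ℂ) by push_cast; linear_combination (1 / 2 : ℂ) * ha]
    simp only [map_smul, LinearMap.smul_apply, smul_eq_mul, Complex.re_ofReal_mul]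
    ring
  have ha0 : (a : ℝ) ≠ 0 := by
    intro h
    have h' : (a : ℂ) = 0 := by exact_mod_cast h
    rw [h'] at ha
    exact hm0 ((mul_eq_zero.1 ha).resolve_left two_ne_zero)
  have hpos' : 0 < (H.form (m • α) (m • α)).re := by
    rw [hform]
    positivity
  obtain ⟨e', f', hp'⟩ := hA.exists_isRootPair hpos' hm
  obtain ⟨b, hb⟩ := hp'.exists_int_of_weightSpace_ne_bot hA (m := m⁻¹)
    (by rwa [smul_smul, inv_mul_cancel₀ hm0, one_smul])
  -- Both `2m` and `2/m` are integers, so that `m` is one of `±1/2`, `±1`, `±2`.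
  have hab : a * b = 4 := by
    have : (a : ℂ) * b = 4 := by
      rw [← ha, ← hb]
      field_simp
      norm_num
    exact_mod_cast this
  have hadvd : a ∣ 4 := ⟨b, hab.symm⟩
  have hle : a ≤ 4 := Int.le_of_dvd (by norm_num) hadvd
  have hge : -4 ≤ a := by
    have := Int.le_of_dvd (by norm_num) (neg_dvd.2 hadvd)
    omega
  have hsm : m = (a : ℂ) / 2 := by linear_combination (1 / 2 : ℂ) * ha
  have hnegpos : 0 < (H.form (-α) (-α)).re := by simpa using hpos
  interval_cases a <;> norm_num at hsm <;> try omega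
  · refine hm ?_
    rw [hsm, show (-2 : ℂ) • α = (2 : ℂ) • -α by module]
    exact hA.weightSpace_two_smul_eq_bot hnegpos hneg
  · exact hm1 hsm
  · refine hneg ?_
    rw [show -α = (2 : ℂ) • m • α by rw [hsm]; module]
    exact hA.weightSpace_two_smul_eq_bot hpos' hm
  · refine hne ?_
    rw [show α = (2 : ℂ) • m • α by rw [hsm]; module]
    exact hA.weightSpace_two_smul_eq_bot hpos' hm
  · exact hm2 hsm
  · refine hm ?_
    rw [hsm]
    exact hA.weightSpace_two_smul_eq_bot hpos hne

end AssumptionA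

end VertexAlgebra

/-! ### The vertex subalgebra generated by the root spaces -/

namespace VertexAlgebra

open AffineSl2 IsAffineTriple

variable {V : Type*} [AddCommGroup V] [Module ℂ V] {A : VertexAlgebra V} {ω : V}
  {H : A.HeisenbergSubspace}

theorem AssumptionA.weightSpace_le_of_mem (hA : A.AssumptionA ω H) {β : H.carrier}
    (hpos : 0 < (H.form β β).re) {a : V} (ha : a ∈ A.weightSpace ω H 1 β) (ha0 : a ≠ 0)
    {U : Submodule ℂ V} (haU : a ∈ U) : A.weightSpace ω H 1 β ≤ U := by
  intro v hv
  obtain ⟨c, hc⟩ := (finrank_eq_one_iff_of_nonzero' (⟨a, ha⟩ : A.weightSpace ω H 1 β)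
    (fun h => ha0 (congrArg Subtype.val h))).1
    (hA.finrank_eq_one hpos ((Submodule.ne_bot_iff _).2 ⟨a, ha, ha0⟩)) ⟨v, hv⟩
  rw [show v = c • a from (congrArg Subtype.val hc).symm]
  exact U.smul_mem c haU

namespace IsRootPair

variable {α : H.carrier} {e f : V} (hA : A.AssumptionA ω H) (hp : IsRootPair A ω H α e f)
include hp hA

theorem slMap_mem_generated (x : Sl2) : slMap α e f x ∈
    A.generated ((A.weightSpace ω H 1 α : Set V) ∪ A.weightSpace ω H 1 (-α)) := by
  have he := A.subset_generated ((A.weightSpace ω H 1 α : Set V) ∪ A.weightSpace ω H 1 (-α))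
    (Or.inl hp.mem_e)
  have hf := A.subset_generated ((A.weightSpace ω H 1 α : Set V) ∪ A.weightSpace ω H 1 (-α))
    (Or.inr hp.mem_f)
  obtain ⟨-, -, -, -, -, -, -, h, -⟩ := hp.products hA
  have ha := A.mode_mem_generated _ he hf 0
  rw [h] at ha
  exact add_mem (add_mem (Submodule.smul_mem _ _ he) (Submodule.smul_mem _ _ hf))
    (Submodule.smul_mem _ _ ha)

/-- A submodule for the affine Lie algebra consisting of the vectors generated from the vacuum
is closed under all products, since the modes of `a(r)b` are combinations of products of modes of
`a` and of `b`. -/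
theorem mode_mem_of_mem {Z : Submodule ℂ V} (hZ : ∀ x n, ∀ v ∈ Z, opMode (hp.rep hA) x n v ∈ Z)
    (u : Env) (n : ℤ) {c : V} (hc : c ∈ Z) : A.mode (hp.rep hA u A.vac) n c ∈ Z := by
  let C : Submodule ℂ V :=
    { carrier := {b | ∀ n : ℤ, ∀ c ∈ Z, A.mode b n c ∈ Z}
      add_mem' := fun {a b} ha hb n c hc => by
        simpa using add_mem (ha n c hc) (hb n c hc)
      zero_mem' := fun n c _ => by simp
      smul_mem' := fun t a ha n c hc => by
        simpa using Submodule.smul_mem _ t (ha n c hc) }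
  have hvac : A.vac ∈ C := fun n c hc => by
    rw [A.vac_mode]
    split_ifs
    · exact hc
    · exact Z.zero_mem
  refine mem_of_opMode_mem (hp.rep hA) (Z := C) (fun x r b hb q c hc => ?_) (fun b hb => ?_) u
    A.vac hvac n c hc
  · have hx : ∀ m : ℤ, ∀ v ∈ Z, A.mode (slMap α e f x) m v ∈ Z := fun m v hv => by
      rw [← hp.opMode_rep hA]
      exact hZ x m v hv
    rw [hp.opMode_rep, A.associator]
    exact finsum_mem_submodule _ fun i => Submodule.smul_mem _ _
      (sub_mem (hx _ _ (hb _ _ hc)) (Submodule.smul_mem _ _ (hb _ _ (hx _ _ hc))))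
  · rw [hp.rep_central]
    exact C.smul_mem _ hb

/-- The vertex subalgebra generated by the root spaces of `±α` is the standard simple affine vertex
algebra. -/
theorem exists_affine : ∃ k : ℕ, 0 < k ∧ (k : ℂ) = 2 / H.form α α ∧
    ∃ B : VertexAlgebra (SimpleQuotient (k : ℂ)), IsStandard B ∧
      ∃ g : B.Hom A, Function.Injective g.toLinearMap ∧
        LinearMap.range g.toLinearMap =
          A.generated ((A.weightSpace ω H 1 α : Set V) ∪ A.weightSpace ω H 1 (-α)) := by
  obtain ⟨K, hK0, hK⟩ := hp.exists_nat_rootLevel hA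
  obtain ⟨Ψ, hinj, hΨvac, hΨact, hΨr⟩ := exists_simpleQuotient_map (R := hp.rep hA) (K := K)
    (v₁ := A.vac) (fun v => by rw [hp.rep_central, hK]) (hp.rep_smooth hA) A.vac_ne_zero
    (hp.opMode_vac hA)
    (fun d j x hx => hp.exists_opMode_slF_pow_eq_zero hA 0 (hp.wordSpan_le_weightSpace hA d j hx))
    (fun d j x hx =>
      hp.exists_opMode_slE_pow_eq_zero hA (-1) (hp.wordSpan_le_weightSpace hA d j hx))
  have hvac : A.vac ∈ LinearMap.range Ψ := ⟨_, hΨvac⟩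
  have hstable : ∀ x n, ∀ v ∈ LinearMap.range Ψ, opMode (hp.rep hA) x n v ∈ LinearMap.range Ψ := by
    rintro x n _ ⟨u, rfl⟩
    exact ⟨_, hΨact x n u⟩
  have hmode : ∀ a b n, A.mode (Ψ a) n (Ψ b) ∈ LinearMap.range Ψ := fun a b n => by
    obtain ⟨u, hu⟩ := (hΨr _).1 ⟨a, rfl⟩
    rw [hu]
    exact hp.mode_mem_of_mem hA hstable u n ⟨b, rfl⟩
  have hcur : ∀ x, Ψ (act K x (-1) (vacuum K)) = slMap α e f x := fun x => by
    rw [hΨact, hΨvac, hp.opMode_rep, A.mode_vac_neg_one]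
  refine ⟨K, hK0, hK.symm, A.pullback Ψ hinj hvac hmode, ⟨hinj ?_, fun x n u => hinj ?_⟩,
    ⟨Ψ, A.map_pullback_vac Ψ hinj hvac hmode,
      fun a b n => A.map_pullback_mode Ψ hinj hvac hmode a n b⟩,
    hinj, le_antisymm ?_ ?_⟩
  · rw [map_pullback_vac, hΨvac]
  · rw [map_pullback_mode, hcur, hΨact, hp.opMode_rep]
  · intro y hy
    obtain ⟨u, rfl⟩ := (hΨr y).1 hy
    refine mem_of_opMode_mem (hp.rep hA) (fun x n v hv => ?_) (fun v hv => ?_) u A.vac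
      (A.vac_mem_generated _)
    · rw [hp.opMode_rep]
      exact A.mode_mem_generated _ (hp.slMap_mem_generated hA x) hv n
    · rw [hp.rep_central]
      exact Submodule.smul_mem _ _ hv
  · have he : e ∈ LinearMap.range Ψ := ⟨_, (hcur slE).trans (slMap_slE α e f)⟩
    have hf : f ∈ LinearMap.range Ψ := by
      have h : rootLevel H α • f ∈ LinearMap.range Ψ := ⟨_, (hcur slF).trans (slMap_slF α e f)⟩
      simpa [smul_smul, inv_mul_cancel₀ hp.rootLevel_ne_zero] using
        Submodule.smul_mem _ (rootLevel H α)⁻¹ h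
    refine sInf_le ⟨hvac, Set.union_subset ?_ ?_, ?_⟩
    · exact hA.weightSpace_le_of_mem hp.pos hp.mem_e hp.e_ne_zero he
    · exact hA.weightSpace_le_of_mem (by simpa using hp.pos) hp.mem_f hp.f_ne_zero hf
    · rintro _ ⟨a, rfl⟩ _ ⟨b, rfl⟩ n
      exact hmode a b n

end IsRootPair

end VertexAlgebra

theorem mainTheorem6 {V : Type*} [AddCommGroup V] [Module ℂ V] (A : VertexAlgebra V) (ω : V)
    (H : A.HeisenbergSubspace) (hA : A.AssumptionA ω H) :
    (∀ α : H.carrier, 0 < (H.form α α).re → A.weightSpace ω H 1 α ≠ ⊥ →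
      (∃ k : ℕ, 0 < k ∧ (k : ℂ) = 2 / H.form α α ∧
        ∃ B : VertexAlgebra (AffineSl2.SimpleQuotient (k : ℂ)), AffineSl2.IsStandard B ∧
          ∃ f : B.Hom A, Function.Injective f.toLinearMap ∧
            LinearMap.range f.toLinearMap =
              A.generated ((A.weightSpace ω H 1 α : Set V) ∪ A.weightSpace ω H 1 (-α))) ∧
      Module.finrank ℂ (A.weightSpace ω H 1 α) = 1 ∧
      Module.finrank ℂ (A.weightSpace ω H 1 (-α)) = 1 ∧
      ∀ m : ℂ, m ≠ -1 → m ≠ 0 → m ≠ 1 → A.weightSpace ω H 1 (m • α) = ⊥) ∧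
    (∀ β ∈ A.weights ω H, ∀ n : ℤ,
      (H.form β β).re / 2 ≤ n → (n : ℝ) - 1 < (H.form β β).re / 2 →
        Module.finrank ℂ (A.weightSpace ω H n β) = 0 ∨
          Module.finrank ℂ (A.weightSpace ω H n β) = 1) := by
  refine ⟨fun α hpos hne => ?_, fun β _ n _ hn => Nat.le_one_iff_eq_zero_or_eq_one.1
    (hA.finrank_weightSpace_le_one hn)⟩
  obtain ⟨e, f, hp⟩ := hA.exists_isRootPair hpos hne
  refine ⟨hp.exists_affine hA, hA.finrank_eq_one hpos hne, hA.finrank_eq_one (by simpa using hpos)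
    ((Submodule.ne_bot_iff _).2 ⟨f, hp.mem_f, hp.f_ne_zero⟩), fun m hm1 hm0 hm2 => ?_⟩
  exact hA.weightSpace_smul_eq_bot hpos hne hm1 hm0 hm2

end
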